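/- Let $\Omega,\beta,\eta>0$ be constants and let $\mathbf M$ be the Fourier multiplier on $\mathbb T^3=(\mathbb R/2\pi\mathbb Z)^3$ with symbol $\widehat{\mathbf M}(k)=0$ if $k_3=0$ and, for $k\in\mathbb Z^3$ with $k_3\neq0$, $$\widehat{\mathbf M}(k)=\frac{\bigl(2\Omega k_2k_3|k|^2-\tfrac{\beta^2}{\eta}k_1k_2^2k_3,\;-2\Omega k_1k_3|k|^2-\tfrac{\beta^2}{\eta}k_2^3k_3,\;\tfrac{\beta^2}{\eta}k_2^2(k_1^2+k_2^2)\bigr)}{4\Omega^2k_3^2|k|^2+(\beta^2/\eta)^2k_2^4}.$$ For $\alpha\in[0,1]$ consider, for real-valued mean-free $\theta$ on $\mathbb T^3$, the generalized magnetogeostrophic (MG) equation $$\partial_t\theta+u\cdot\nabla\theta=0,\qquad u=(-\Delta)^{\alpha/2}\mathbf M\theta,\qquad \theta(\cdot,0)=\theta_0 .\qquad (*)$$ Let $H^q$ have the norm $\|\theta\|_{H^q}^2=\sum_{k}(1+|k|^2)^q|\hat\theta(k)|^2$. Fix $r>3$ and, for $s>0$, $\tau>0$, let $G^s_\tau$ be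 the space of real-valued mean-free $\theta$ with $$\|\theta\|_{G^s_\tau}^2=\sum_{k\ne0}|k|^{2r}e^{2\tau|k|^{1/s}}|\hat\theta(k)|^2<\infty .$$ A solution of $(*)$ in $L^\infty(0,T;H^q)$ is understood in the integrated distributional sense: $\theta(t)=\theta_0-\int_0^t(u\cdot\nabla\theta)\,d\sigma$ in the sense of distributions on $\mathbb T^3$ for every $t\in[0,T]$. The equation is called locally Lipschitz $(H^q,G^s_\tau)$ well-posed if there are continuous functions $T,K:[0,\infty)^2\to(0,\infty)$ such that for all $\theta_0^{(1)},\theta_0^{(2)}\in G^s_\tau$, with $T,K$ evaluated at $(\|\theta_0^{(1)}\|_{G^s_\tau},\|\theta_0^{(2)}\|_{G^s_\tau})$, there exist unique real-valued mean-free solutions $\theta^{(1)},\theta^{(2)}\in L^\infty(0,T;H^q)$ with these initial data, and they satisfy $$\|\theta^{(1)}(t)-\theta^{(2)}(t)\|_{H^q}\le K\,\|\theta^{(1)}_0-\theta^{(2)}_0\|_{G^s_\tau}\qquad\text{for all }t\in[0,T];$$ it is called locally Lipschitz $(H^q,G^s_\tau)$ ill-posed if it is not well-posed in this sense. **Theorem.**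 Let $\alpha\in[0,1]$, $q>\alpha+\frac74$ and $s>\frac1{\alpha+1}$. Then the equation $(*)$ is locally Lipschitz $(H^q,G^s_\tau)$ ill-posed for every $\tau>0$. In particular, the non-diffusive MG equation ($\alpha=0$, $u=\mathbf M\theta$) is locally Lipschitz $(H^q,G^s_\tau)$ ill-posed for all $q>\frac74$, $s>1$ and $\tau>0$. -/

import Mathlib

open MeasureTheory Set
open scoped ENNReal NNReal

noncomputable section

namespace ActiveScalar

/-- Frequencies `k = (k₁, k₂, k₃)` are indexed as `k 0, k 1, k 2`. -/
abbrev Freq : Type := Fin 3 → ℤ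

/-- The torus `𝕋³ = (ℝ / 2πℤ)³`, written in the coordinates `y = x / 2π`. In these coordinates
`UnitAddTorus.mFourier k` is the character `x ↦ exp (i k · x)`, the normalised Haar measure is
`(2π)⁻³ dx`, and `UnitAddTorus.mFourierCoeff f k` is the Fourier coefficient
`(2π)⁻³ ∫ f(x) exp (-i k · x) dx`. All differential operators below are taken in the variable `x`,
that is, `∂ⱼ` is the Fourier multiplier with symbol `i kⱼ`. -/
abbrev Torus : Type := UnitAddTorus (Fin 3)

/-- The normalised Haar measure `(2π)⁻³ dx` on the torus (the one of Mathlib's Fourier theory). -/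
abbrev torusMeasure : Measure Torus := Measure.pi fun _ => AddCircle.haarAddCircle

/-- The Hilbert space `L²(𝕋³; ℂ)`. -/
abbrev L2 : Type := Lp ℂ 2 torusMeasure

/-- The Fourier coefficient of `f` at frequency `k`. -/
def coeff (f : Torus → ℂ) (k : Freq) : ℂ := UnitAddTorus.mFourierCoeff f k

/-- `|k|²`. -/
def normSq (k : Freq) : ℝ := ∑ i, (k i : ℝ) ^ 2

/-- `|k|`. -/
def kNorm (k : Freq) : ℝ := Real.sqrt (normSq k)

/-- Real-valued, mean-free functions in `L²(𝕋³)`. -/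
def RealMeanFree (f : L2) : Prop :=
  (∀ᵐ x ∂torusMeasure, (f x).im = 0) ∧ coeff f 0 = 0

open Classical in
/-- The Fourier multiplier operator with symbol `m`: the element of `L²` with Fourier coefficients
`m k * f̂ k`. The value is `0` if `f` is not in the domain of the operator, that is, if these
numbers are not square summable. -/
def multiplier (m : Freq → ℂ) (f : L2) : L2 :=
  if h : Memℓp (fun k => m k * coeff f k) 2 then
    UnitAddTorus.mFourierBasis.repr.symm ⟨fun k => m k * coeff f k, h⟩
  else 0

/-- The `j`-th component of `u = T θ`, for the Fourier multiplier with symbol `T : ℤ³ → ℝ³`. -/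
def velocity (T : Freq → Fin 3 → ℝ) (θ : L2) (j : Fin 3) : L2 :=
  multiplier (fun k => (T k j : ℂ)) θ

/-- The weak partial derivative `∂ⱼ θ`. -/
def partialDeriv (θ : L2) (j : Fin 3) : L2 :=
  multiplier (fun k => Complex.I * (k j : ℂ)) θ

/-- The nonlinearity `u · ∇θ` with `u = T θ`. -/
def advection (T : Freq → Fin 3 → ℝ) (θ : L2) : Torus → ℂ :=
  fun x => ∑ j, velocity T θ j x * partialDeriv θ j x

/-- The Sobolev norm of `H^q`, with value `∞` outside `H^q`. -/
def sobolevNorm (q : ℝ) (f : L2) : ℝ≥0∞ :=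
  (∑' k : Freq, ENNReal.ofReal ((1 + normSq k) ^ q * ‖coeff f k‖ ^ 2)) ^ (1 / 2 : ℝ)

/-- The Gevrey norm of `G^s_τ`, where `r` is the fixed Sobolev exponent in its definition, with
value `∞` outside `G^s_τ`. -/
def gevreyNorm (r s τ : ℝ) (f : L2) : ℝ≥0∞ :=
  (∑' k : {k : Freq // k ≠ 0}, ENNReal.ofReal
    (kNorm k ^ (2 * r) * Real.exp (2 * τ * kNorm k ^ (1 / s)) * ‖coeff f k‖ ^ 2)) ^ (1 / 2 : ℝ)

/-- `θ ∈ L^∞(0, t₁; X)` is a solution on `[0, t₁]` of `∂ₜθ + u · ∇θ = 0`, `u = T θ`, with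
`θ(0) = θ₀`. Here `X` is the space of real mean-free `f` with `normX f < ∞`. The equation is taken
in integrated form `θ(t) = θ₀ - ∫₀ᵗ (u · ∇θ)(s) ds` in the sense of distributions on `𝕋³`, that is,
for every Fourier coefficient. -/
structure IsSolution (T : Freq → Fin 3 → ℝ) (normX : L2 → ℝ≥0∞) (t₁ : ℝ) (θ₀ : L2)
    (θ : ℝ → L2) : Prop where
  realMeanFree : ∀ t ∈ Icc 0 t₁, RealMeanFree (θ t)
  measurable : AEStronglyMeasurable θ (volume.restrict (Icc 0 t₁))
  bounded : essSup (fun t => normX (θ t)) (volume.restrict (Icc 0 t₁)) < ∞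
  integrable : ∀ k : Freq,
    IntervalIntegrable (fun σ => coeff (advection T (θ σ)) k) volume 0 t₁
  equation : ∀ t ∈ Icc 0 t₁, ∀ k : Freq,
    coeff (θ t) k = coeff θ₀ k - ∫ σ in (0 : ℝ)..t, coeff (advection T (θ σ)) k

/-- Local Lipschitz `(X, Y)` well-posedness of `∂ₜθ + u · ∇θ = 0`, `u = T θ`, where `X` and `Y` are
the spaces of real mean-free functions on which `normX`, resp. `normY`, is finite. -/
def LipschitzWellPosed (T : Freq → Fin 3 → ℝ) (normX normY : L2 → ℝ≥0∞) : Prop :=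
  ∃ time lip : ℝ≥0 × ℝ≥0 → ℝ,
    Continuous time ∧ Continuous lip ∧ (∀ p, 0 < time p) ∧ (∀ p, 0 < lip p) ∧
    ∀ φ₁ φ₂ : L2, RealMeanFree φ₁ → normY φ₁ < ∞ → RealMeanFree φ₂ → normY φ₂ < ∞ →
      ∃ θ₁ θ₂ : ℝ → L2,
        IsSolution T normX (time ((normY φ₁).toNNReal, (normY φ₂).toNNReal)) φ₁ θ₁ ∧
        IsSolution T normX (time ((normY φ₁).toNNReal, (normY φ₂).toNNReal)) φ₂ θ₂ ∧
        (∀ θ, IsSolution T normX (time ((normY φ₁).toNNReal, (normY φ₂).toNNReal)) φ₁ θ →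
          EqOn θ θ₁ (Icc 0 (time ((normY φ₁).toNNReal, (normY φ₂).toNNReal)))) ∧
        (∀ θ, IsSolution T normX (time ((normY φ₁).toNNReal, (normY φ₂).toNNReal)) φ₂ θ →
          EqOn θ θ₂ (Icc 0 (time ((normY φ₁).toNNReal, (normY φ₂).toNNReal)))) ∧
        ∀ t ∈ Icc 0 (time ((normY φ₁).toNNReal, (normY φ₂).toNNReal)),
          normX (θ₁ t - θ₂ t) ≤
            ENNReal.ofReal (lip ((normY φ₁).toNNReal, (normY φ₂).toNNReal)) * normY (φ₁ - φ₂)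

/-- Local Lipschitz `(X, Y)` ill-posedness is the failure of well-posedness. -/
def LipschitzIllPosed (T : Freq → Fin 3 → ℝ) (normX normY : L2 → ℝ≥0∞) : Prop :=
  ¬ LipschitzWellPosed T normX normY

/-- The Fourier symbol of the magnetogeostrophic operator `M`. -/
def mgSymbol (Ω β η : ℝ) (k : Freq) : Fin 3 → ℝ :=
  let k₁ : ℝ := k 0
  let k₂ : ℝ := k 1
  let k₃ : ℝ := k 2
  let D : ℝ := 4 * Ω ^ 2 * k₃ ^ 2 * normSq k + (β ^ 2 / η) ^ 2 * k₂ ^ 4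
  if k 2 = 0 then 0 else
    ![(2 * Ω * k₂ * k₃ * normSq k - (β ^ 2 / η) * k₁ * k₂ ^ 2 * k₃) / D,
      (-2 * Ω * k₁ * k₃ * normSq k - (β ^ 2 / η) * k₂ ^ 3 * k₃) / D,
      ((β ^ 2 / η) * k₂ ^ 2 * (k₁ ^ 2 + k₂ ^ 2)) / D]

/-- The Fourier symbol of `(-Δ)^{α/2} M`. -/
def generalizedMGSymbol (Ω β η α : ℝ) (k : Freq) : Fin 3 → ℝ :=
  kNorm k ^ α • mgSymbol Ω β η k

end ActiveScalar

end

noncomputable section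

namespace ActiveScalar

/-! The profile `steady` $=-2\sin x_3$ is stationary, because the symbol vanishes at $\pm(0,0,1)$.
For $\theta=\mathrm{steady}+w$ the equation reads $\partial_t w=2\cos x_3\,(Tw)_3-Tw\cdot\nabla w$.
Multiplication by $2\cos x_3$ shifts $k_3$ by $\pm1$, so on the frequencies $(a,b,p)$ the linear
part is a chain $\dot w_p=m_{p-1}w_{p-1}+m_{p+1}w_{p+1}$, where $m_p$ is the third symbol component.
All $m_p\ge0$ and $m_0=0$, so the half $p\ge1$ is closed. The modes $p=1,2$ feed each other, and by
comparison they grow at least like $e^{\mu t}$ with $\mu\le\min(m_1,m_2)$ (`chain_lower_bound`,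
`chain_growth`).

With $(a,b)=(n^2,n)$ and $N=n^2$ one may take $\mu=cN^{\alpha+1}$ (`le_generalizedMGSymbol_mode`),
while the Gevrey norm $G$ of the two modes is at most a constant times $N^re^{\tau(3N)^{1/s}}$
(`gevreyNorm_perturbation_le`).

Well-posedness applied to `steady` and to its perturbation of size $\varepsilon$ keeps $w$ within
$K\varepsilon G$ in $H^q$. The quadratic term is then $O(\varepsilon^2)$ in every Fourier
coefficient. Dividing by $\varepsilon$ and letting $\varepsilon\to0$ at fixed $n$ gives $e^{\mu
T}\le KG$ with $T,K$ independent of $n$ (`exp_le_of_wellPosed`). Since $1/s<\alpha+1$, this fails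
for large $n$. -/

instance : IsProbabilityMeasure torusMeasure := by
  unfold torusMeasure; infer_instance

/-! ### Fourier coefficients: linearity, single modes, products -/

theorem coeff_eq_repr (f : L2) (k : Freq) :
    coeff f k = UnitAddTorus.mFourierBasis.repr f k :=
  (UnitAddTorus.mFourierBasis_repr f k).symm

theorem L2.ext_coeff {f g : L2} (h : ∀ k, coeff f k = coeff g k) : f = g := by
  apply UnitAddTorus.mFourierBasis.repr.injective
  ext k
  rw [← coeff_eq_repr, ← coeff_eq_repr, h]

theorem coeff_add (f g : L2) (k : Freq) : coeff (f + g : L2) k = coeff f k + coeff g k := by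
  simp only [coeff_eq_repr, map_add]; rfl

theorem coeff_sub (f g : L2) (k : Freq) : coeff (f - g : L2) k = coeff f k - coeff g k := by
  simp only [coeff_eq_repr, map_sub]; rfl

theorem coeff_smul (c : ℂ) (f : L2) (k : Freq) : coeff (c • f : L2) k = c * coeff f k := by
  simp only [coeff_eq_repr, map_smul]; rfl

theorem coeff_congr_ae {f g : Torus → ℂ} (h : f =ᵐ[torusMeasure] g) (k : Freq) :
    coeff f k = coeff g k := by
  unfold coeff UnitAddTorus.mFourierCoeff
  apply integral_congr_ae
  filter_upwards [h] with x hx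
  rw [hx]

theorem coeff_multiplier {m : Freq → ℂ} {f : L2} (h : Memℓp (fun k => m k * coeff f k) 2)
    (k : Freq) : coeff (multiplier m f) k = m k * coeff f k := by
  rw [multiplier, dif_pos h, coeff_eq_repr, LinearIsometryEquiv.apply_symm_apply]

theorem memlp_two_iff {a : Freq → ℂ} : Memℓp a 2 ↔ Summable fun k => ‖a k‖ ^ 2 := by
  rw [memℓp_gen_iff (by norm_num)]
  simp

theorem hasSum_norm_sq_coeff (f : L2) :
    HasSum (fun k => ‖coeff f k‖ ^ 2) (∫ x, ‖f x‖ ^ 2 ∂torusMeasure) :=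
  UnitAddTorus.hasSum_sq_mFourierCoeff f

/-- The character `x ↦ exp (i k · x)` as an element of `L²`. -/
def expMode (k : Freq) : L2 := UnitAddTorus.mFourierLp 2 k

theorem coeFn_expMode (k : Freq) : expMode k =ᵐ[torusMeasure] UnitAddTorus.mFourier k :=
  UnitAddTorus.coeFn_mFourierLp 2 k

theorem coeff_expMode (k l : Freq) : coeff (expMode k) l = if l = k then 1 else 0 := by
  rw [coeff_eq_repr, expMode, ← UnitAddTorus.coe_mFourierBasis, HilbertBasis.repr_self,
    lp.single_apply, Pi.single_apply]

/-- The real-valued function `x ↦ 2 Re (z exp (i k · x))`. -/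
def realMode (z : ℂ) (k : Freq) : L2 := z • expMode k + (starRingEnd ℂ z) • expMode (-k)

theorem coeff_realMode (z : ℂ) (k l : Freq) :
    coeff (realMode z k) l =
      z * (if l = k then 1 else 0) + starRingEnd ℂ z * (if l = -k then 1 else 0) := by
  rw [realMode, coeff_add, coeff_smul, coeff_smul, coeff_expMode, coeff_expMode]

theorem coeff_realMode_eq_zero {z : ℂ} {k l : Freq} (h : l ≠ k) (h' : l ≠ -k) :
    coeff (realMode z k) l = 0 := by
  rw [coeff_realMode, if_neg h, if_neg h']; simp

theorem realMeanFree_realMode (z : ℂ) {k : Freq} (hk : k ≠ 0) : RealMeanFree (realMode z k) := by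
  refine ⟨?_, coeff_realMode_eq_zero hk.symm (by simpa [eq_comm] using hk)⟩
  filter_upwards [coeFn_expMode k, coeFn_expMode (-k),
    Lp.coeFn_add (z • expMode k) ((starRingEnd ℂ z) • expMode (-k)),
    Lp.coeFn_smul z (expMode k), Lp.coeFn_smul (starRingEnd ℂ z) (expMode (-k))]
    with x h1 h2 h3 h4 h5
  rw [realMode, h3, Pi.add_apply, h4, h5, Pi.smul_apply, Pi.smul_apply, h1, h2,
    UnitAddTorus.mFourier_neg, smul_eq_mul, smul_eq_mul, ← map_mul, Complex.add_im,
    Complex.conj_im, add_neg_cancel]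

theorem RealMeanFree.add {f g : L2} (hf : RealMeanFree f) (hg : RealMeanFree g) :
    RealMeanFree (f + g) := by
  refine ⟨?_, by rw [coeff_add, hf.2, hg.2, add_zero]⟩
  filter_upwards [hf.1, hg.1, Lp.coeFn_add f g] with x h1 h2 h3
  rw [h3, Pi.add_apply, Complex.add_im, h1, h2, add_zero]

theorem RealMeanFree.smul {f : L2} (hf : RealMeanFree f) (c : ℝ) :
    RealMeanFree ((c : ℂ) • f) := by
  refine ⟨?_, by rw [coeff_smul, hf.2, mul_zero]⟩
  filter_upwards [hf.1, Lp.coeFn_smul (c : ℂ) f] with x h1 h3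
  rw [h3, Pi.smul_apply, smul_eq_mul, Complex.im_ofReal_mul, h1, mul_zero]

theorem integrable_mul_L2 (f g : L2) : Integrable (fun x => f x * g x) torusMeasure :=
  MemLp.integrable_mul (p := 2) (q := 2) (Lp.memLp f) (Lp.memLp g)

theorem integrable_mFourier_smul {f : Torus → ℂ} (hf : Integrable f torusMeasure) (k : Freq) :
    Integrable (fun x => UnitAddTorus.mFourier k x • f x) torusMeasure := by
  refine hf.bdd_mul (c := 1) (UnitAddTorus.mFourier k).continuous.aestronglyMeasurable ?_
  refine Filter.Eventually.of_forall fun x => ?_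
  exact ((UnitAddTorus.mFourier k).norm_coe_le_norm x).trans UnitAddTorus.mFourier_norm.le

theorem coeff_add_of_integrable {f g : Torus → ℂ} (hf : Integrable f torusMeasure)
    (hg : Integrable g torusMeasure) (k : Freq) :
    coeff (fun x => f x + g x) k = coeff f k + coeff g k := by
  unfold coeff UnitAddTorus.mFourierCoeff
  simp only [smul_add]
  exact integral_add (integrable_mFourier_smul hf _) (integrable_mFourier_smul hg _)

theorem coeff_mul_mFourier (f : Torus → ℂ) (k l : Freq) :
    coeff (fun x => f x * UnitAddTorus.mFourier k x) l = coeff f (l - k) := by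
  unfold coeff UnitAddTorus.mFourierCoeff
  congr 1
  ext x
  rw [neg_sub, sub_eq_add_neg, UnitAddTorus.mFourier_add, smul_eq_mul, smul_eq_mul]
  ring

/-- Pointwise $|fg|\le|f|^2+|g|^2$. This crude bound is all that is used on the quadratic term,
since only individual Fourier coefficients have to be controlled. -/
theorem norm_coeff_mul_le (f g : L2) (k : Freq) :
    ‖coeff (fun x => f x * g x) k‖ ≤
      (∫ x, ‖f x‖ ^ 2 ∂torusMeasure) + ∫ x, ‖g x‖ ^ 2 ∂torusMeasure := by
  have hf : Integrable (fun x => ‖f x‖ ^ 2) torusMeasure := (Lp.memLp f).integrable_norm_pow'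
  have hg : Integrable (fun x => ‖g x‖ ^ 2) torusMeasure := (Lp.memLp g).integrable_norm_pow'
  rw [← integral_add hf hg]
  unfold coeff UnitAddTorus.mFourierCoeff
  refine norm_integral_le_of_norm_le (hf.add hg) (Filter.Eventually.of_forall fun x => ?_)
  have h1 : ‖UnitAddTorus.mFourier (-k) x‖ ≤ 1 :=
    ((UnitAddTorus.mFourier (-k)).norm_coe_le_norm x).trans UnitAddTorus.mFourier_norm.le
  have h2 : 0 ≤ ‖f x‖ * ‖g x‖ := by positivity
  rw [norm_smul, norm_mul]
  have h3 := mul_le_mul_of_nonneg_right h1 h2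
  nlinarith [sq_nonneg (‖f x‖ - ‖g x‖), sq_nonneg (‖f x‖), sq_nonneg (‖g x‖)]

/-! ### Sobolev bounds and multipliers -/

theorem normSq_nonneg (k : Freq) : 0 ≤ normSq k := Finset.sum_nonneg fun _ _ => sq_nonneg _

theorem kNorm_nonneg (k : Freq) : 0 ≤ kNorm k := Real.sqrt_nonneg _

theorem normSq_neg (k : Freq) : normSq (-k) = normSq k := by simp [normSq]

theorem kNorm_neg (k : Freq) : kNorm (-k) = kNorm k := by rw [kNorm, kNorm, normSq_neg]

/-- A quantitative form of `f ∈ H^q`. -/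
def SobolevBound (q δ : ℝ) (f : L2) : Prop :=
  Summable (fun k : Freq => (1 + normSq k) ^ q * ‖coeff f k‖ ^ 2) ∧
    ∑' k : Freq, (1 + normSq k) ^ q * ‖coeff f k‖ ^ 2 ≤ δ ^ 2

theorem sobolev_term_nonneg (q : ℝ) (f : L2) (k : Freq) :
    0 ≤ (1 + normSq k) ^ q * ‖coeff f k‖ ^ 2 := by
  have := normSq_nonneg k
  positivity

theorem sobolevBound_of_sobolevNorm_le {q δ : ℝ} {f : L2} (hδ : 0 ≤ δ)
    (h : sobolevNorm q f ≤ ENNReal.ofReal δ) : SobolevBound q δ f := by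
  have h1 : ∑' k : Freq, ENNReal.ofReal ((1 + normSq k) ^ q * ‖coeff f k‖ ^ 2) ≤
      ENNReal.ofReal (δ ^ 2) := by
    have := ENNReal.rpow_le_rpow h (zero_le_two (α := ℝ))
    rw [sobolevNorm, ← ENNReal.rpow_mul] at this
    norm_num at this
    rwa [ENNReal.ofReal_pow hδ]
  have hs : Summable (fun k : Freq => (1 + normSq k) ^ q * ‖coeff f k‖ ^ 2) := by
    have h2 := ENNReal.summable_toReal (ne_top_of_le_ne_top ENNReal.ofReal_ne_top h1)
    refine h2.congr fun k => ?_
    rw [ENNReal.toReal_ofReal (sobolev_term_nonneg q f k)]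
  refine ⟨hs, ?_⟩
  rw [← ENNReal.ofReal_tsum_of_nonneg (sobolev_term_nonneg q f) hs] at h1
  exact (ENNReal.ofReal_le_ofReal_iff (sq_nonneg δ)).1 h1

theorem SobolevBound.norm_coeff_le {q δ : ℝ} {f : L2} (hq : 0 ≤ q) (hδ : 0 ≤ δ)
    (h : SobolevBound q δ f) (k : Freq) : ‖coeff f k‖ ≤ δ := by
  have h1 := (h.1.le_tsum k fun l _ => sobolev_term_nonneg q f l).trans h.2
  have h2 : 1 ≤ (1 + normSq k) ^ q := Real.one_le_rpow (by linarith [normSq_nonneg k]) hq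
  have h3 := le_mul_of_one_le_left (sq_nonneg ‖coeff f k‖) h2
  exact (sq_le_sq₀ (norm_nonneg _) hδ).1 (h3.trans h1)

theorem SobolevBound.memlp_multiplier {q δ C : ℝ} {f : L2} {m : Freq → ℂ}
    (hm : ∀ k, ‖m k‖ ^ 2 ≤ C * (1 + normSq k) ^ q) (h : SobolevBound q δ f) :
    Memℓp (fun k => m k * coeff f k) 2 := by
  rw [memlp_two_iff]
  refine Summable.of_nonneg_of_le (fun _ => sq_nonneg _) (fun k => ?_) (h.1.mul_left C)
  rw [norm_mul, mul_pow, ← mul_assoc]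
  exact mul_le_mul_of_nonneg_right (hm k) (sq_nonneg _)

/-- Parseval, compared term by term with the $H^q$ sum. -/
theorem SobolevBound.integral_multiplier_le {q δ C : ℝ} {f : L2} {m : Freq → ℂ} (hC : 0 ≤ C)
    (hm : ∀ k, ‖m k‖ ^ 2 ≤ C * (1 + normSq k) ^ q) (h : SobolevBound q δ f) :
    ∫ x, ‖multiplier m f x‖ ^ 2 ∂torusMeasure ≤ C * δ ^ 2 := by
  have h1 := hasSum_norm_sq_coeff (multiplier m f)
  rw [← h1.tsum_eq]
  refine le_trans ?_ (mul_le_mul_of_nonneg_left h.2 hC)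
  rw [← tsum_mul_left]
  refine h1.summable.tsum_le_tsum (fun k => ?_) (h.1.mul_left C)
  rw [coeff_multiplier (h.memlp_multiplier hm), norm_mul, mul_pow, ← mul_assoc]
  exact mul_le_mul_of_nonneg_right (hm k) (sq_nonneg _)

/-! ### Comparison principle for infinite chains -/

theorem integral_exp_mul_const (c t : ℝ) :
    ∫ s in (0 : ℝ)..t, c * Real.exp (c * s) = Real.exp (c * t) - 1 := by
  have h : ∀ s ∈ uIcc 0 t, HasDerivAt (fun s => Real.exp (c * s)) (c * Real.exp (c * s)) s := by
    intro s _
    have := ((hasDerivAt_id s).const_mul c).exp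
    simpa [mul_comm] using this
  rw [intervalIntegral.integral_eq_sub_of_hasDerivAt h
    (Continuous.intervalIntegrable (by fun_prop) _ _)]
  simp

/-- A subsolution argument for an infinite chain with nonnegative nearest-neighbour coupling. -/
theorem chain_lower_bound {m : ℕ → ℝ} {Λ η t₁ B : ℝ} {e : ℕ → ℝ → ℝ}
    (hm₀ : m 0 = 0) (hm : ∀ p, 0 ≤ m p) (hmΛ : ∀ p, m p ≤ Λ) (hη : 0 ≤ η) (ht₁ : 0 ≤ t₁)
    (hcont : ∀ p, ContinuousOn (e p) (Icc 0 t₁)) (hB : 0 ≤ B)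
    (hbdd : ∀ p, ∀ t ∈ Icc 0 t₁, -B ≤ e (p + 1) t)
    (heqn : ∀ p, ∀ t ∈ Icc 0 t₁,
      ∫ s in (0 : ℝ)..t, (m p * e p s + m (p + 2) * e (p + 2) s - η) ≤ e (p + 1) t)
    (p : ℕ) (t : ℝ) (ht : t ∈ Icc 0 t₁) :
    -(2 * η * t₁ * Real.exp (4 * Λ * t)) ≤ e (p + 1) t := by
  have hΛ : 0 ≤ Λ := (hm 0).trans (hmΛ 0)
  -- Picard-type iteration: inserting a lower bound into the integral inequality halves the
  -- contribution of $B$. The rate $4\Lambda$ is chosen so that two neighbours, each weighted by at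
  -- most $\Lambda$, integrate to the factor $1/2$.
  have step : ∀ n : ℕ, ∀ p, ∀ t ∈ Icc 0 t₁,
      -((B / 2 ^ n + 2 * η * t₁) * Real.exp (4 * Λ * t)) ≤ e (p + 1) t := by
    intro n
    induction n with
    | zero =>
      intro p t ht
      refine le_trans ?_ (hbdd p t ht)
      have h1 : 1 ≤ Real.exp (4 * Λ * t) := Real.one_le_exp (by have := ht.1; positivity)
      have h2 : 0 ≤ η * t₁ := by positivity
      have h3 : B + 2 * η * t₁ ≤ (B + 2 * η * t₁) * Real.exp (4 * Λ * t) :=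
        le_mul_of_one_le_right (by positivity) h1
      simp only [pow_zero, div_one]
      linarith
    | succ n ih =>
      intro p t ht
      set X := B / 2 ^ n + 2 * η * t₁ with hX
      have hX0 : 0 ≤ X := by positivity
      have hsub : ∀ s ∈ Icc 0 t, s ∈ Icc 0 t₁ := fun s hs => ⟨hs.1, hs.2.trans ht.2⟩
      have hint : IntervalIntegrable
          (fun s => m p * e p s + m (p + 2) * e (p + 2) s - η) volume 0 t := by
        refine ContinuousOn.intervalIntegrable_of_Icc ht.1 ?_
        have h1 := (hcont p).mono hsub
        have h2 := (hcont (p + 2)).mono hsub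
        fun_prop
      have hpt : ∀ q, ∀ s ∈ Icc 0 t, -(Λ * (X * Real.exp (4 * Λ * s))) ≤ m q * e q s := by
        intro q s hs
        -- The entry `e 0` has no lower bound; it only occurs multiplied by `m 0 = 0`.
        rcases q with _ | q
        · rw [hm₀, zero_mul, neg_nonpos]
          positivity
        · have h1 := ih q s (hsub s hs)
          have h2 : 0 ≤ X * Real.exp (4 * Λ * s) := by positivity
          have h3 := mul_le_mul_of_nonneg_left h1 (hm (q + 1))
          have h4 := mul_le_mul_of_nonneg_right (hmΛ (q + 1)) h2
          linarith
      have hmono : ∫ s in (0 : ℝ)..t, ((-(X / 2)) * (4 * Λ * Real.exp (4 * Λ * s)) - η) ≤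
          ∫ s in (0 : ℝ)..t, (m p * e p s + m (p + 2) * e (p + 2) s - η) := by
        refine intervalIntegral.integral_mono_on ht.1
          (Continuous.intervalIntegrable (by fun_prop) _ _) hint ?_
        intro s hs
        have h1 := hpt p s hs
        have h2 := hpt (p + 2) s hs
        linarith
      rw [intervalIntegral.integral_sub (Continuous.intervalIntegrable (by fun_prop) _ _)
        (Continuous.intervalIntegrable (by fun_prop) _ _), intervalIntegral.integral_const_mul,
        integral_exp_mul_const, intervalIntegral.integral_const, smul_eq_mul, sub_zero] at hmono
      refine le_trans ?_ (hmono.trans (heqn p t ht))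
      have h1 : 1 ≤ Real.exp (4 * Λ * t) := Real.one_le_exp (by have := ht.1; positivity)
      have h2 : t * η ≤ t₁ * η * Real.exp (4 * Λ * t) :=
        (mul_le_mul_of_nonneg_right ht.2 hη).trans
          (le_mul_of_one_le_right (by positivity) h1)
      -- The map $X\mapsto X/2+\eta t_1$ has fixed point $2\eta t_1$, which is the constant
      -- surviving in the limit.
      have h3 : (B / 2 ^ (n + 1) + 2 * η * t₁) = X / 2 + η * t₁ := by
        rw [hX, pow_succ]; ring
      rw [h3]
      nlinarith
  have hlim : Filter.Tendsto
      (fun n : ℕ => -((B / 2 ^ n + 2 * η * t₁) * Real.exp (4 * Λ * t))) Filter.atTop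
      (nhds (-((0 + 2 * η * t₁) * Real.exp (4 * Λ * t)))) := by
    have h : Filter.Tendsto (fun n : ℕ => B / (2 : ℝ) ^ n) Filter.atTop (nhds 0) :=
      tendsto_const_nhds.div_atTop (tendsto_pow_atTop_atTop_of_one_lt (by norm_num))
    exact ((h.add_const _).mul_const _).neg
  rw [zero_add] at hlim
  exact le_of_tendsto' hlim fun n => step n p t ht

/-- Exponential growth of the first entry of a chain with nonnegative nearest-neighbour coupling,
driven by the interaction of the first two entries. -/
theorem chain_growth {m : ℕ → ℝ} {Λ μ η ε t₁ B : ℝ} {b : ℕ → ℝ} {x : ℕ → ℝ → ℝ}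
    (hm₀ : m 0 = 0) (hm : ∀ p, 0 ≤ m p) (hmΛ : ∀ p, m p ≤ Λ) (hμ : 0 ≤ μ)
    (hμ₁ : μ ≤ m 1) (hμ₂ : μ ≤ m 2) (hη : 0 ≤ η) (hε : 0 ≤ ε) (ht₁ : 0 ≤ t₁)
    (hcont : ∀ p, ContinuousOn (x p) (Icc 0 t₁)) (hB : 0 ≤ B)
    (hbdd : ∀ p, ∀ t ∈ Icc 0 t₁, -B ≤ x p t)
    (hb : ∀ p, 0 ≤ b p) (hb₁ : b 1 = ε) (hb₂ : b 2 = ε)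
    (heqn : ∀ p, ∀ t ∈ Icc 0 t₁,
      b (p + 1) + ∫ s in (0 : ℝ)..t, (m p * x p s + m (p + 2) * x (p + 2) s - η)
        ≤ x (p + 1) t) :
    ε * Real.exp (μ * t₁) - 2 * η * t₁ * Real.exp (4 * Λ * t₁) ≤ x 1 t₁ := by
  -- Explicit subsolution of the unforced chain: entry 1 is driven by entry 2 through `m 2 ≥ μ`, and
  -- entry 2 by entry 1 through `m 1 ≥ μ`; elsewhere zero suffices because the coupling is
  -- nonnegative.
  set y : ℕ → ℝ → ℝ := fun p t => if p = 1 ∨ p = 2 then ε * Real.exp (μ * t) else 0 with hy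
  have hy₁ : ∀ t, y 1 t = ε * Real.exp (μ * t) := fun t => by simp [hy]
  have hy₂ : ∀ t, y 2 t = ε * Real.exp (μ * t) := fun t => by simp [hy]
  have hy0 : ∀ p t, 0 ≤ y p t := by
    intro p t
    simp only [hy]
    split_ifs <;> positivity
  have hycont : ∀ p, Continuous (y p) := by
    intro p
    simp only [hy]
    split_ifs <;> fun_prop
  have hyle : ∀ p, ∀ t ∈ Icc 0 t₁, y p t ≤ ε * Real.exp (μ * t₁) := by
    intro p t ht
    simp only [hy]
    split_ifs
    · have := ht.2
      gcongr
    · positivity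
  have hyint : ∀ p t, IntervalIntegrable
      (fun s => m p * y p s + m (p + 2) * y (p + 2) s) volume 0 t := by
    intro p t
    have h1 := hycont p
    have h2 := hycont (p + 2)
    exact Continuous.intervalIntegrable (by fun_prop) _ _
  have hexp : ∀ t : ℝ, ∫ s in (0 : ℝ)..t, ε * (μ * Real.exp (μ * s)) =
      ε * Real.exp (μ * t) - ε := by
    intro t
    rw [intervalIntegral.integral_const_mul, integral_exp_mul_const]
    ring
  have hysub : ∀ p, ∀ t ∈ Icc 0 t₁, y (p + 1) t ≤
      b (p + 1) + ∫ s in (0 : ℝ)..t, (m p * y p s + m (p + 2) * y (p + 2) s) := by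
    intro p t ht
    have key : ∀ p, (∀ s, ε * (μ * Real.exp (μ * s)) ≤ m p * y p s + m (p + 2) * y (p + 2) s) →
        ε * Real.exp (μ * t) - ε ≤
          ∫ s in (0 : ℝ)..t, (m p * y p s + m (p + 2) * y (p + 2) s) := by
      intro p h
      rw [← hexp]
      exact intervalIntegral.integral_mono_on ht.1
        (Continuous.intervalIntegrable (by fun_prop) _ _) (hyint p t) fun s _ => h s
    have hE : ∀ s, 0 ≤ ε * Real.exp (μ * s) := fun s => by positivity
    rcases p with _ | _ | p
    · have := key 0 fun s => by
        rw [hm₀, zero_mul, zero_add, zero_add, hy₂]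
        nlinarith [hE s]
      rw [zero_add, hy₁, hb₁]
      linarith
    · have := key 1 fun s => by
        rw [hy₁]
        have := mul_nonneg (hm (1 + 2)) (hy0 (1 + 2) s)
        nlinarith [hE s]
      rw [zero_add, one_add_one_eq_two, hy₂, hb₂]
      linarith
    · have h1 : y (p + 1 + 1 + 1) t = 0 := by simp [hy]
      rw [h1]
      refine add_nonneg (hb _) (intervalIntegral.integral_nonneg ht.1 fun s _ => ?_)
      exact add_nonneg (mul_nonneg (hm _) (hy0 _ _)) (mul_nonneg (hm _) (hy0 _ _))
  -- By linearity `x - y` is a supersolution with zero initial data, so only the forcing `η` can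
  -- push it below zero.
  have hmain := chain_lower_bound (m := m) (Λ := Λ) (η := η) (t₁ := t₁)
    (B := B + ε * Real.exp (μ * t₁)) (e := fun p t => x p t - y p t) hm₀ hm hmΛ hη ht₁
    (fun p => (hcont p).sub (hycont p).continuousOn) (by positivity)
    (fun p t ht => by linarith [hbdd (p + 1) t ht, hyle (p + 1) t ht])
    (fun p t ht => by
      have hsub : ∀ s ∈ Icc 0 t, s ∈ Icc 0 t₁ := fun s hs => ⟨hs.1, hs.2.trans ht.2⟩
      have hint : IntervalIntegrable
          (fun s => m p * x p s + m (p + 2) * x (p + 2) s - η) volume 0 t := by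
        refine ContinuousOn.intervalIntegrable_of_Icc ht.1 ?_
        have h1 := (hcont p).mono hsub
        have h2 := (hcont (p + 2)).mono hsub
        fun_prop
      have hsplit : ∫ s in (0 : ℝ)..t,
          (m p * (x p s - y p s) + m (p + 2) * (x (p + 2) s - y (p + 2) s) - η) =
          (∫ s in (0 : ℝ)..t, (m p * x p s + m (p + 2) * x (p + 2) s - η)) -
          ∫ s in (0 : ℝ)..t, (m p * y p s + m (p + 2) * y (p + 2) s) := by
        rw [← intervalIntegral.integral_sub hint (hyint p t)]
        congr 1
        ext s
        ring
      simp only [hsplit]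
      linarith [heqn p t ht, hysub p t ht])
    0 t₁ (right_mem_Icc.2 ht₁)
  simp only [zero_add, hy₁] at hmain
  linarith

/-! ### The steady state and the linearisation there -/

/-- The frequency `(0, 0, 1)`. -/
def axis : Freq := ![0, 0, 1]

/-- The stationary solution `-2 sin x₃`. -/
def steady : L2 := realMode Complex.I axis

theorem axis_ne_zero : axis ≠ 0 := fun h => by simpa [axis] using congrFun h 2

theorem axis_ne_neg : axis ≠ -axis := fun h => by
  have := congrFun h 2
  simp [axis] at this

theorem realMeanFree_steady : RealMeanFree steady := realMeanFree_realMode _ axis_ne_zero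

theorem coeff_steady_axis : coeff steady axis = Complex.I := by
  rw [steady, coeff_realMode, if_pos rfl, if_neg axis_ne_neg]; simp

theorem coeff_steady_neg_axis : coeff steady (-axis) = -Complex.I := by
  rw [steady, coeff_realMode, if_pos rfl, if_neg axis_ne_neg.symm]; simp

theorem coeff_steady_of_ne {k : Freq} (h : k ≠ axis) (h' : k ≠ -axis) : coeff steady k = 0 :=
  coeff_realMode_eq_zero h h'

theorem memlp_of_support {a : Freq → ℂ} (S : Finset Freq) (h : ∀ k ∉ S, a k = 0) :
    Memℓp a 2 :=
  memlp_two_iff.2 (summable_of_ne_finset_zero (s := S) fun k hk => by simp [h k hk])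

theorem memlp_mul_coeff_steady (m : Freq → ℂ) : Memℓp (fun k => m k * coeff steady k) 2 := by
  refine memlp_of_support {axis, -axis} fun k hk => ?_
  simp only [Finset.mem_insert, Finset.mem_singleton, not_or] at hk
  rw [coeff_steady_of_ne hk.1 hk.2, mul_zero]

theorem partialDeriv_steady_two : partialDeriv steady 2 = -(expMode axis + expMode (-axis)) := by
  refine L2.ext_coeff fun k => ?_
  rw [partialDeriv, coeff_multiplier (memlp_mul_coeff_steady _), ← neg_one_smul ℂ, coeff_smul,
    coeff_add, coeff_expMode, coeff_expMode]
  by_cases h : k = axis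
  · subst h
    rw [coeff_steady_axis, if_pos rfl, if_neg axis_ne_neg]
    simp [axis]
  by_cases h' : k = -axis
  · subst h'
    rw [coeff_steady_neg_axis, if_pos rfl, if_neg axis_ne_neg.symm]
    simp [axis]
  rw [coeff_steady_of_ne h h', if_neg h, if_neg h']
  simp

theorem partialDeriv_steady_of_ne {j : Fin 3} (hj : j ≠ 2) : partialDeriv steady j = 0 := by
  refine L2.ext_coeff fun k => ?_
  have h0 : coeff (0 : L2) k = 0 := by simpa using coeff_smul 0 (0 : L2) k
  have haxis : axis j = 0 := by fin_cases j <;> simp_all [axis]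
  rw [partialDeriv, coeff_multiplier (memlp_mul_coeff_steady _), h0]
  by_cases h : k = axis
  · simp [h, haxis]
  by_cases h' : k = -axis
  · simp [h', haxis]
  rw [coeff_steady_of_ne h h', mul_zero]

variable {T : Freq → Fin 3 → ℝ}

/-- Membership in the domain depends only on the products, so the default value `0` is taken for
both functions or for neither. -/
theorem multiplier_congr {m : Freq → ℂ} {f g : L2}
    (h : (fun k => m k * coeff f k) = fun k => m k * coeff g k) :
    multiplier m f = multiplier m g := by
  by_cases hf : Memℓp (fun k => m k * coeff f k) 2
  · refine L2.ext_coeff fun k => ?_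
    rw [coeff_multiplier hf, coeff_multiplier (h ▸ hf)]
    exact congrFun h k
  · rw [multiplier, multiplier, dif_neg hf, dif_neg (h ▸ hf)]

theorem velocity_steady_add (hT : ∀ j, T axis j = 0) (hT' : ∀ j, T (-axis) j = 0) (w : L2)
    (j : Fin 3) : velocity T (steady + w) j = velocity T w j := by
  have : (fun k => (T k j : ℂ) * coeff (steady + w : L2) k) =
      fun k => (T k j : ℂ) * coeff w k := by
    ext k
    rw [coeff_add]
    by_cases h : k = axis
    · simp [h, hT]
    by_cases h' : k = -axis
    · simp [h', hT']
    rw [coeff_steady_of_ne h h', zero_add]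
  exact multiplier_congr this

theorem partialDeriv_add {f g : L2} (j : Fin 3)
    (hf : Memℓp (fun k => Complex.I * (k j : ℂ) * coeff f k) 2)
    (hg : Memℓp (fun k => Complex.I * (k j : ℂ) * coeff g k) 2) :
    partialDeriv (f + g) j = partialDeriv f j + partialDeriv g j := by
  have hfg : Memℓp (fun k => Complex.I * (k j : ℂ) * coeff (f + g : L2) k) 2 := by
    convert hf.add hg using 1
    ext k
    rw [coeff_add, Pi.add_apply, mul_add]
  refine L2.ext_coeff fun k => ?_
  rw [coeff_add, partialDeriv, partialDeriv, partialDeriv, coeff_multiplier hfg,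
    coeff_multiplier hf, coeff_multiplier hg, coeff_add, mul_add]

/-- Here $\partial_3$ of the steady state is $-2\cos x_3=-(e^{ix_3}+e^{-ix_3})$, and each
exponential shifts the frequency. This is the source of the nearest-neighbour coupling. -/
theorem coeff_mul_partialDeriv_steady (f : L2) (k : Freq) :
    coeff (fun x => f x * partialDeriv steady 2 x) k =
      -(coeff f (k - axis) + coeff f (k + axis)) := by
  have h : (fun x => f x * partialDeriv steady 2 x) =ᵐ[torusMeasure] fun x =>
      (-(1 : ℂ)) * (f x * UnitAddTorus.mFourier axis x) +
        (-(1 : ℂ)) * (f x * UnitAddTorus.mFourier (-axis) x) := by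
    rw [partialDeriv_steady_two]
    filter_upwards [Lp.coeFn_neg (expMode axis + expMode (-axis)),
      Lp.coeFn_add (expMode axis) (expMode (-axis)), coeFn_expMode axis, coeFn_expMode (-axis)]
      with x h1 h2 h3 h4
    rw [h1, Pi.neg_apply, h2, Pi.add_apply, h3, h4]
    ring
  have hint : ∀ l, Integrable (fun x => (-(1 : ℂ)) * (f x * UnitAddTorus.mFourier l x))
      torusMeasure := by
    intro l
    have h1 : Integrable f torusMeasure := (Lp.memLp f).integrable (by norm_num)
    have h2 := (integrable_mFourier_smul h1 l).const_mul (-1)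
    refine h2.congr (Filter.Eventually.of_forall fun x => ?_)
    simp only [smul_eq_mul]
    ring
  have hneg : ∀ l, coeff (fun x => (-(1 : ℂ)) * (f x * UnitAddTorus.mFourier l x)) k =
      -coeff f (k - l) := by
    intro l
    rw [← coeff_mul_mFourier]
    unfold coeff UnitAddTorus.mFourierCoeff
    rw [← integral_neg]
    congr 1
    ext x
    simp only [smul_eq_mul]
    ring
  rw [coeff_congr_ae h, coeff_add_of_integrable (hint _) (hint _), hneg, hneg, sub_neg_eq_add]
  ring

/-- The steady state has zero velocity and depends on $x_3$ only, so of the cross terms just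
$(Tw)_3\,\partial_3\mathrm{steady}$ survives. -/
theorem coeff_advection_steady_add (hT : ∀ j, T axis j = 0) (hT' : ∀ j, T (-axis) j = 0)
    {w : L2} (hw : ∀ j : Fin 3, Memℓp (fun k => Complex.I * (k j : ℂ) * coeff w k) 2) (k : Freq) :
    coeff (advection T (steady + w)) k = (∑ j, coeff (fun x => velocity T w j x *
      partialDeriv w j x) k) -
      (coeff (velocity T w 2) (k - axis) + coeff (velocity T w 2) (k + axis)) := by
  have hD : ∀ j, partialDeriv (steady + w) j = partialDeriv steady j + partialDeriv w j :=
    fun j => partialDeriv_add j (memlp_mul_coeff_steady _) (hw j)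
  have h : advection T (steady + w) =ᵐ[torusMeasure] fun x =>
      (velocity T w 0 x * partialDeriv w 0 x + (velocity T w 1 x * partialDeriv w 1 x +
        (velocity T w 2 x * partialDeriv w 2 x))) +
        velocity T w 2 x * partialDeriv steady 2 x := by
    filter_upwards [Lp.coeFn_add (partialDeriv steady 2) (partialDeriv w 2)] with x h2
    simp only [advection, velocity_steady_add hT hT', Fin.sum_univ_three]
    rw [hD 2, h2, hD 0, hD 1, partialDeriv_steady_of_ne (by decide),
      partialDeriv_steady_of_ne (by decide), zero_add, zero_add, Pi.add_apply]
    ring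
  have hi : ∀ j, Integrable (fun x => velocity T w j x * partialDeriv w j x) torusMeasure :=
    fun j => integrable_mul_L2 _ _
  have hi' : Integrable (fun x => velocity T w 1 x * partialDeriv w 1 x +
      velocity T w 2 x * partialDeriv w 2 x) torusMeasure := (hi 1).add (hi 2)
  have hi'' : Integrable (fun x => velocity T w 0 x * partialDeriv w 0 x +
      (velocity T w 1 x * partialDeriv w 1 x + velocity T w 2 x * partialDeriv w 2 x))
      torusMeasure := (hi 0).add hi'
  rw [coeff_congr_ae h, coeff_add_of_integrable hi'' (integrable_mul_L2 _ _),
    coeff_mul_partialDeriv_steady, coeff_add_of_integrable (hi 0) hi',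
    coeff_add_of_integrable (hi 1) (hi 2), Fin.sum_univ_three]
  ring

theorem sq_le_normSq (k : Freq) (j : Fin 3) : (k j : ℝ) ^ 2 ≤ normSq k :=
  Finset.single_le_sum (f := fun i => (k i : ℝ) ^ 2) (fun _ _ => sq_nonneg _) (Finset.mem_univ j)

theorem norm_deriv_symbol_le {q : ℝ} (hq : 1 ≤ q) (j : Fin 3) (k : Freq) :
    ‖Complex.I * (k j : ℂ)‖ ^ 2 ≤ 1 * (1 + normSq k) ^ q := by
  have h1 : (1 + normSq k) ≤ (1 + normSq k) ^ q :=
    Real.self_le_rpow_of_one_le (by linarith [normSq_nonneg k]) hq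
  rw [norm_mul, Complex.norm_I, one_mul, Complex.norm_intCast, sq_abs, one_mul]
  linarith [sq_le_normSq k j]

/-- Near the steady state the equation is linear up to a quadratic error. -/
theorem norm_coeff_advection_steady_add_le {q δ C : ℝ} (hq : 1 ≤ q) (hC : 0 ≤ C)
    (hT : ∀ j, T axis j = 0) (hT' : ∀ j, T (-axis) j = 0)
    (hTC : ∀ k j, T k j ^ 2 ≤ C * (1 + normSq k) ^ q) {w : L2} (hw : SobolevBound q δ w)
    (k : Freq) :
    ‖coeff (advection T (steady + w)) k + ((T (k - axis) 2 : ℂ) * coeff w (k - axis) +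
      (T (k + axis) 2 : ℂ) * coeff w (k + axis))‖ ≤ 3 * (C + 1) * δ ^ 2 := by
  have hTC' : ∀ j k, ‖(T k j : ℂ)‖ ^ 2 ≤ C * (1 + normSq k) ^ q := fun j k => by
    rw [Complex.norm_real, Real.norm_eq_abs, sq_abs]
    exact hTC k j
  rw [coeff_advection_steady_add hT hT'
    (fun j => hw.memlp_multiplier (norm_deriv_symbol_le hq j)), velocity,
    coeff_multiplier (hw.memlp_multiplier (hTC' 2)),
    coeff_multiplier (hw.memlp_multiplier (hTC' 2)), sub_add_cancel]
  refine (norm_sum_le _ _).trans ?_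
  have hj : ∀ j ∈ Finset.univ, ‖coeff (fun x => velocity T w j x * partialDeriv w j x) k‖ ≤
      (C + 1) * δ ^ 2 := by
    intro j _
    refine (norm_coeff_mul_le _ _ _).trans ?_
    have h1 := hw.integral_multiplier_le hC (hTC' j)
    have h2 := hw.integral_multiplier_le zero_le_one (norm_deriv_symbol_le hq j)
    rw [velocity, partialDeriv]
    linarith
  refine (Finset.sum_le_sum hj).trans (le_of_eq ?_)
  simp only [Finset.sum_const, Finset.card_univ, Fintype.card_fin, nsmul_eq_mul]
  push_cast
  ring

theorem coeff_advection_steady (hT : ∀ j, T axis j = 0) (hT' : ∀ j, T (-axis) j = 0) (k : Freq) :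
    coeff (advection T steady) k = 0 := by
  have h0 : ∀ k, coeff (0 : L2) k = 0 := fun k => by simpa using coeff_smul 0 (0 : L2) k
  have hv : ∀ j, velocity T steady j = 0 := by
    intro j
    refine L2.ext_coeff fun k => ?_
    rw [velocity, coeff_multiplier (memlp_mul_coeff_steady _), h0]
    by_cases h : k = axis
    · simp [h, hT]
    by_cases h' : k = -axis
    · simp [h', hT']
    rw [coeff_steady_of_ne h h', mul_zero]
  have h : advection T steady =ᵐ[torusMeasure] (0 : L2) := by
    filter_upwards [Lp.coeFn_zero ℂ 2 torusMeasure] with x hx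
    simp only [advection, hv]
    rw [hx]
    simp
  rw [coeff_congr_ae h, h0]

/-! ### Upper bounds, sign and growth of the symbol -/

theorem normSq_eq (k : Freq) : normSq k = (k 0 : ℝ) ^ 2 + (k 1 : ℝ) ^ 2 + (k 2 : ℝ) ^ 2 := by
  simp [normSq, Fin.sum_univ_three]

theorem kNorm_sq (k : Freq) : kNorm k ^ 2 = normSq k := Real.sq_sqrt (normSq_nonneg k)

theorem abs_le_kNorm (k : Freq) (j : Fin 3) : |(k j : ℝ)| ≤ kNorm k :=
  Real.abs_le_sqrt (sq_le_normSq k j)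

theorem one_le_sq_of_ne_zero {z : ℤ} (h : z ≠ 0) : (1 : ℝ) ≤ (z : ℝ) ^ 2 := by
  have : (1 : ℤ) ≤ z ^ 2 := by have := Int.one_le_abs h; nlinarith [sq_abs z]
  exact_mod_cast this

theorem mgSymbol_of_eq_zero {Ω β η : ℝ} {k : Freq} (h : k 2 = 0) : mgSymbol Ω β η k = 0 := by
  simp [mgSymbol, h]

theorem mgSymbol_axis {Ω β η : ℝ} : mgSymbol Ω β η axis = 0 := by
  ext j
  fin_cases j <;> simp [mgSymbol, axis]

theorem mgSymbol_neg_axis {Ω β η : ℝ} : mgSymbol Ω β η (-axis) = 0 := by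
  ext j
  fin_cases j <;> simp [mgSymbol, axis]

/-- The magnetogeostrophic operator has order at most one. -/
theorem abs_mgSymbol_le {Ω β η : ℝ} (hΩ : 0 < Ω) (hβ : 0 < β) (hη : 0 < η) (k : Freq)
    (j : Fin 3) : |mgSymbol Ω β η k j| ≤ 1 / Ω * kNorm k := by
  by_cases h : k 2 = 0
  · rw [mgSymbol_of_eq_zero h, Pi.zero_apply, abs_zero]
    exact mul_nonneg (by positivity) (kNorm_nonneg k)
  have hκ : 0 < β ^ 2 / η := by positivity
  have h3 := one_le_sq_of_ne_zero h
  have ha1 := abs_le_kNorm k 0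
  have ha2 := abs_le_kNorm k 1
  have ha3 : 1 ≤ |(k 2 : ℝ)| := by
    rw [← sq_abs] at h3
    nlinarith [abs_nonneg (k 2 : ℝ)]
  have hM1 : 1 ≤ kNorm k := ha3.trans (abs_le_kNorm k 2)
  have hN := kNorm_sq k
  have hNe := normSq_eq k
  simp only [mgSymbol, h, if_false]
  set κ := β ^ 2 / η
  set k₁ : ℝ := (k 0 : ℝ)
  set k₂ : ℝ := (k 1 : ℝ)
  set k₃ : ℝ := (k 2 : ℝ)
  set M := kNorm k
  rw [← hN] at hNe ⊢
  clear_value κ k₁ k₂ k₃ M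
  set D := 4 * Ω ^ 2 * k₃ ^ 2 * M ^ 2 + κ ^ 2 * k₂ ^ 4 with hD
  have hDpos : 0 < D := by positivity
  -- Since $k_3$ is a nonzero integer, $M\ge1$ and hence $|k_i|\le M\le M^2$.
  have e1 : |k₁| ≤ M ^ 2 := by nlinarith
  have e2 : |k₂| ≤ M ^ 2 := by nlinarith
  have e3 : k₁ ^ 2 + k₂ ^ 2 ≤ M ^ 2 := by nlinarith [sq_nonneg k₃]
  -- the arithmetic-geometric mean inequality
  have hamgm : 4 * Ω * κ * |k₃| * M * k₂ ^ 2 ≤ D := by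
    rw [hD, ← sq_abs k₃]
    nlinarith [sq_nonneg (2 * Ω * |k₃| * M - κ * k₂ ^ 2)]
  have hfirst : ∀ a : ℝ, |a| ≤ M → |2 * Ω * a * k₃ * M ^ 2| ≤ 1 / (2 * Ω) * M * D := by
    intro a ha
    have h1 : 1 / (2 * Ω) * M * (4 * Ω ^ 2 * k₃ ^ 2 * M ^ 2) ≤ 1 / (2 * Ω) * M * D := by
      refine mul_le_mul_of_nonneg_left ?_ (by positivity)
      rw [hD]
      have : 0 ≤ κ ^ 2 * k₂ ^ 4 := by positivity
      linarith
    refine le_trans ?_ h1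
    have h2 : 1 / (2 * Ω) * M * (4 * Ω ^ 2 * k₃ ^ 2 * M ^ 2) = 2 * Ω * M ^ 2 * (M * |k₃| ^ 2) := by
      rw [sq_abs]; field_simp; ring
    rw [h2, abs_mul, abs_mul, abs_mul, abs_of_pos (by positivity : 0 < 2 * Ω),
      abs_of_nonneg (sq_nonneg M)]
    have h4 : |a| * |k₃| ≤ M * |k₃| ^ 2 :=
      mul_le_mul ha (by nlinarith) (abs_nonneg _) (by positivity)
    nlinarith [mul_le_mul_of_nonneg_left h4 (by positivity : 0 ≤ 2 * Ω * M ^ 2)]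
  have hsecond : ∀ a : ℝ, 0 ≤ a → a ≤ M ^ 2 → κ * a * k₂ ^ 2 * |k₃| ≤ 1 / (4 * Ω) * M * D := by
    intro a ha0 ha
    refine le_trans ?_ (mul_le_mul_of_nonneg_left hamgm (by positivity))
    have h2 : 1 / (4 * Ω) * M * (4 * Ω * κ * |k₃| * M * k₂ ^ 2) = κ * M ^ 2 * k₂ ^ 2 * |k₃| := by
      field_simp
    rw [h2]
    gcongr
  have hfin : ∀ b : ℝ, |b| ≤ 1 / (2 * Ω) * M * D + 1 / (4 * Ω) * M * D → |b / D| ≤ 1 / Ω * M := by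
    intro b hb
    rw [abs_div, abs_of_pos hDpos, div_le_iff₀ hDpos]
    refine hb.trans ?_
    have : 1 / Ω * M * D - (1 / (2 * Ω) * M * D + 1 / (4 * Ω) * M * D) = 1 / (4 * Ω) * M * D := by
      field_simp; ring
    have h5 : 0 ≤ 1 / (4 * Ω) * M * D := by positivity
    linarith
  fin_cases j
  · refine hfin _ ((abs_sub _ _).trans (add_le_add (hfirst k₂ ha2) ?_))
    rw [abs_mul, abs_mul, abs_mul, abs_of_pos hκ, abs_of_nonneg (sq_nonneg k₂)]
    exact hsecond _ (abs_nonneg _) e1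
  · refine hfin _ ((abs_sub _ _).trans (add_le_add ?_ ?_))
    · rw [show -2 * Ω * k₁ * k₃ * M ^ 2 = -(2 * Ω * k₁ * k₃ * M ^ 2) by ring, abs_neg]
      exact hfirst k₁ ha1
    · have : |κ * k₂ ^ 3 * k₃| = κ * |k₂| * k₂ ^ 2 * |k₃| := by
        rw [abs_mul, abs_mul, abs_of_pos hκ, pow_succ, abs_mul, abs_of_nonneg (sq_nonneg k₂)]
        ring
      rw [this]
      exact hsecond _ (abs_nonneg _) e2
  · refine hfin _ ?_
    have h6 := hsecond (k₁ ^ 2 + k₂ ^ 2) (by positivity) e3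
    have h7 : 0 ≤ κ * k₂ ^ 2 * (k₁ ^ 2 + k₂ ^ 2) := by positivity
    have h8 : 0 ≤ 1 / (2 * Ω) * M * D := by positivity
    change |κ * k₂ ^ 2 * (k₁ ^ 2 + k₂ ^ 2)| ≤ _
    rw [abs_of_nonneg h7]
    nlinarith

theorem sq_generalizedMGSymbol_le {Ω β η α q : ℝ} (hΩ : 0 < Ω) (hβ : 0 < β) (hη : 0 < η)
    (hα : 0 ≤ α) (hq : α + 1 ≤ q) (k : Freq) (j : Fin 3) :
    generalizedMGSymbol Ω β η α k j ^ 2 ≤ (1 / Ω) ^ 2 * (1 + normSq k) ^ q := by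
  have hN := normSq_nonneg k
  have h1 : mgSymbol Ω β η k j ^ 2 ≤ (1 / Ω) ^ 2 * normSq k := by
    rw [← kNorm_sq, ← mul_pow, ← sq_abs]
    exact pow_le_pow_left₀ (abs_nonneg _) (abs_mgSymbol_le hΩ hβ hη k j) 2
  have h2 : (kNorm k ^ α) ^ 2 ≤ (1 + normSq k) ^ α := by
    rw [← Real.rpow_natCast, ← Real.rpow_mul (kNorm_nonneg k), mul_comm α,
      Real.rpow_mul (kNorm_nonneg k), Real.rpow_natCast, kNorm_sq]
    exact Real.rpow_le_rpow hN (by linarith) hα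
  calc generalizedMGSymbol Ω β η α k j ^ 2
      = (kNorm k ^ α) ^ 2 * mgSymbol Ω β η k j ^ 2 := by
        simp only [generalizedMGSymbol, Pi.smul_apply, smul_eq_mul, mul_pow]
    _ ≤ (1 + normSq k) ^ α * ((1 / Ω) ^ 2 * (1 + normSq k)) := by
        refine mul_le_mul h2 (h1.trans ?_) (sq_nonneg _) (by positivity)
        gcongr
        linarith
    _ = (1 / Ω) ^ 2 * (1 + normSq k) ^ (α + 1) := by
        rw [Real.rpow_add (by linarith), Real.rpow_one]; ring
    _ ≤ (1 / Ω) ^ 2 * (1 + normSq k) ^ q := by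
        gcongr
        linarith

theorem generalizedMGSymbol_two {Ω β η α : ℝ} {k : Freq} (h : k 2 ≠ 0) :
    generalizedMGSymbol Ω β η α k 2 = kNorm k ^ α *
      (((β ^ 2 / η) * (k 1 : ℝ) ^ 2 * ((k 0 : ℝ) ^ 2 + (k 1 : ℝ) ^ 2)) /
      (4 * Ω ^ 2 * (k 2 : ℝ) ^ 2 * normSq k + (β ^ 2 / η) ^ 2 * (k 1 : ℝ) ^ 4)) := by
  simp [generalizedMGSymbol, mgSymbol, h]

theorem generalizedMGSymbol_of_eq_zero {Ω β η α : ℝ} {k : Freq} (h : k 2 = 0) :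
    generalizedMGSymbol Ω β η α k = 0 := by
  rw [generalizedMGSymbol, mgSymbol_of_eq_zero h, smul_zero]

theorem generalizedMGSymbol_two_nonneg {Ω β η α : ℝ} (hη : 0 < η) (k : Freq) :
    0 ≤ generalizedMGSymbol Ω β η α k 2 := by
  by_cases h : k 2 = 0
  · rw [generalizedMGSymbol_of_eq_zero h]; simp
  have := normSq_nonneg k
  have := kNorm_nonneg k
  rw [generalizedMGSymbol_two h]
  positivity

/-- The factor $|k|^\alpha\le|k|^2$ is absorbed by $k_3^2|k|^2$ in the denominator. The bound does
not involve $k_3$, so it serves as the uniform coupling constant $\Lambda$ along a whole chain. -/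
theorem generalizedMGSymbol_two_le {Ω β η α : ℝ} (hΩ : 0 < Ω) (hη : 0 < η) (hα : α ≤ 1)
    (k : Freq) : generalizedMGSymbol Ω β η α k 2 ≤
      (β ^ 2 / η) * (k 1 : ℝ) ^ 2 * ((k 0 : ℝ) ^ 2 + (k 1 : ℝ) ^ 2) / (4 * Ω ^ 2) := by
  by_cases h : k 2 = 0
  · rw [generalizedMGSymbol_of_eq_zero h, Pi.zero_apply]
    positivity
  have h3 := one_le_sq_of_ne_zero h
  have hN : 1 ≤ normSq k := h3.trans (sq_le_normSq k 2)
  have hM : 1 ≤ kNorm k := Real.one_le_sqrt.2 hN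
  have hpow : kNorm k ^ α ≤ normSq k := by
    rw [← kNorm_sq]
    calc kNorm k ^ α ≤ kNorm k ^ (1 : ℝ) := Real.rpow_le_rpow_of_exponent_le hM hα
      _ ≤ kNorm k ^ 2 := by rw [Real.rpow_one]; nlinarith
  rw [generalizedMGSymbol_two h, ← mul_div_assoc, div_le_div_iff₀ (by positivity) (by positivity)]
  set P := β ^ 2 / η * (k 1 : ℝ) ^ 2 * ((k 0 : ℝ) ^ 2 + (k 1 : ℝ) ^ 2)
  have hP : 0 ≤ P := by positivity
  have h4 : kNorm k ^ α * (4 * Ω ^ 2) ≤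
      4 * Ω ^ 2 * (k 2 : ℝ) ^ 2 * normSq k + (β ^ 2 / η) ^ 2 * (k 1 : ℝ) ^ 4 := by
    have h5 : normSq k * (4 * Ω ^ 2) ≤ 4 * Ω ^ 2 * (k 2 : ℝ) ^ 2 * normSq k := by
      have : 0 ≤ 4 * Ω ^ 2 * normSq k := by positivity
      nlinarith
    have h6 : 0 ≤ (β ^ 2 / η) ^ 2 * (k 1 : ℝ) ^ 4 := by positivity
    have h7 := mul_le_mul_of_nonneg_right hpow (by positivity : 0 ≤ 4 * Ω ^ 2)
    linarith
  nlinarith [mul_le_mul_of_nonneg_left h4 hP]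

/-! ### The unstable chain of frequencies -/

/-- The frequency `(a, b, p)`. -/
def mode (a b : ℤ) (p : ℕ) : Freq := ![a, b, (p : ℤ)]

@[simp] theorem mode_zero_apply (a b : ℤ) (p : ℕ) : mode a b p 0 = a := rfl
@[simp] theorem mode_one_apply (a b : ℤ) (p : ℕ) : mode a b p 1 = b := rfl
@[simp] theorem mode_two_apply (a b : ℤ) (p : ℕ) : mode a b p 2 = p := rfl

/-- The scaling $k_1=k_2^2$ balances the two terms of the denominator, both of order $n^4$ for
bounded $k_3$. The numerator has order $n^6$, so the quotient is of order $n^2\sim|k|$: the full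
order one of the operator is attained. -/
theorem le_generalizedMGSymbol_mode {Ω β η α : ℝ} (hΩ : 0 < Ω) (hβ : 0 < β) (hη : 0 < η)
    (hα : 0 ≤ α) {n : ℕ} (hn : 1 ≤ n) {p : ℕ} (hp : p ≠ 0) (hp2 : p ≤ 2) :
    (β ^ 2 / η) / (96 * Ω ^ 2 + (β ^ 2 / η) ^ 2) * ((n : ℝ) ^ 2) ^ (α + 1) ≤
      generalizedMGSymbol Ω β η α (mode (n ^ 2) n p) 2 := by
  have hn' : (1 : ℝ) ≤ n := by exact_mod_cast hn
  have hp' : (p : ℝ) ≤ 2 := by exact_mod_cast hp2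
  have hp2' : (p : ℝ) ^ 2 ≤ 4 := by nlinarith [(Nat.cast_nonneg p : (0 : ℝ) ≤ p)]
  have hκ : 0 < β ^ 2 / η := by positivity
  have hM : (n : ℝ) ^ 2 ≤ kNorm (mode (n ^ 2) n p) := by
    have := abs_le_kNorm (mode (n ^ 2) n p) 0
    simpa using this
  have hpow : ((n : ℝ) ^ 2) ^ α ≤ kNorm (mode (n ^ 2) n p) ^ α :=
    Real.rpow_le_rpow (by positivity) hM hα
  have hN : normSq (mode (n ^ 2) n p) ≤ 6 * (n : ℝ) ^ 4 := by
    rw [normSq_eq]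
    simp only [mode_zero_apply, mode_one_apply, mode_two_apply]
    push_cast
    have h1 : (1 : ℝ) ≤ (n : ℝ) ^ 2 := one_le_pow₀ hn'
    nlinarith
  have hNpos : 0 < normSq (mode (n ^ 2) n p) := by
    rw [← kNorm_sq]
    have : 0 < (n : ℝ) ^ 2 := by positivity
    have := this.trans_le hM
    positivity
  have hpp : (0 : ℝ) < p := by exact_mod_cast Nat.pos_of_ne_zero hp
  rw [generalizedMGSymbol_two (by simpa using hp), Real.rpow_add (by positivity), Real.rpow_one,
    mul_comm (((n : ℝ) ^ 2) ^ α), ← mul_assoc, mul_comm]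
  refine mul_le_mul hpow ?_ (by positivity) (Real.rpow_nonneg (kNorm_nonneg _) _)
  simp only [mode_zero_apply, mode_one_apply, mode_two_apply]
  push_cast
  set κ := β ^ 2 / η
  set N := normSq (mode (n ^ 2) n p)
  -- $96=4\cdot4\cdot6$, from $p^2\le4$ and $|k|^2\le6n^4$.
  have hD : 4 * Ω ^ 2 * (p : ℝ) ^ 2 * N + κ ^ 2 * (n : ℝ) ^ 4 ≤
      (96 * Ω ^ 2 + κ ^ 2) * (n : ℝ) ^ 4 := by
    have h1 : (p : ℝ) ^ 2 * N ≤ 4 * (6 * (n : ℝ) ^ 4) :=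
      mul_le_mul hp2' hN hNpos.le (by norm_num)
    nlinarith [mul_le_mul_of_nonneg_left h1 (by positivity : 0 ≤ 4 * Ω ^ 2)]
  calc κ / (96 * Ω ^ 2 + κ ^ 2) * (n : ℝ) ^ 2
      = κ * (n : ℝ) ^ 2 * ((n : ℝ) ^ 2) ^ 2 / ((96 * Ω ^ 2 + κ ^ 2) * (n : ℝ) ^ 4) := by
        field_simp
    _ ≤ κ * (n : ℝ) ^ 2 * (((n : ℝ) ^ 2) ^ 2 + (n : ℝ) ^ 2) /
        (4 * Ω ^ 2 * (p : ℝ) ^ 2 * N + κ ^ 2 * (n : ℝ) ^ 4) := by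
        gcongr
        have := sq_nonneg (n : ℝ)
        linarith

theorem mode_injective (a b : ℤ) : Function.Injective (mode a b) := fun p q h => by
  have := congrFun h 2
  simpa using this

theorem mode_ne_neg_mode {a b : ℤ} (hb : b ≠ 0) (p q : ℕ) : mode a b p ≠ -mode a b q := fun h => by
  have := congrFun h 1
  simp only [mode_one_apply, Pi.neg_apply] at this
  omega

theorem mode_ne_zero {a b : ℤ} (hb : b ≠ 0) (p : ℕ) : mode a b p ≠ 0 := fun h =>
  hb (by simpa using congrFun h 1)

theorem mode_ne_axis {a b : ℤ} (hb : b ≠ 0) (p : ℕ) : mode a b p ≠ axis := fun h =>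
  hb (by simpa [axis] using congrFun h 1)

theorem mode_ne_neg_axis {a b : ℤ} (hb : b ≠ 0) (p : ℕ) : mode a b p ≠ -axis := fun h =>
  hb (by simpa [axis] using congrFun h 1)

theorem mode_succ_sub_axis (a b : ℤ) (p : ℕ) : mode a b (p + 1) - axis = mode a b p := by
  ext j
  fin_cases j <;> simp [mode, axis]

theorem mode_succ_add_axis (a b : ℤ) (p : ℕ) : mode a b (p + 1) + axis = mode a b (p + 2) := by
  ext j
  fin_cases j <;> simp [mode, axis]
  ring

/-- The trigonometric polynomial `2 cos (k · x) + 2 cos (k' · x)` with `k = (a, b, 1)` and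
`k' = (a, b, 2)`. -/
def perturbation (a b : ℤ) : L2 := realMode 1 (mode a b 1) + realMode 1 (mode a b 2)

theorem realMeanFree_perturbation (a : ℤ) {b : ℤ} (hb : b ≠ 0) :
    RealMeanFree (perturbation a b) :=
  (realMeanFree_realMode _ (mode_ne_zero hb 1)).add (realMeanFree_realMode _ (mode_ne_zero hb 2))

/-- For $b\ne0$ the conjugate frequencies lie off the chain, so they do not contribute. -/
theorem coeff_perturbation_mode (a : ℤ) {b : ℤ} (hb : b ≠ 0) (p : ℕ) :
    coeff (perturbation a b) (mode a b p) = if p = 1 ∨ p = 2 then 1 else 0 := by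
  rw [perturbation, coeff_add, coeff_realMode, coeff_realMode, if_neg (mode_ne_neg_mode hb _ _),
    if_neg (mode_ne_neg_mode hb _ _)]
  simp only [(mode_injective a b).eq_iff]
  by_cases h1 : p = 1
  · simp [h1]
  by_cases h2 : p = 2
  · simp [h2]
  simp [h1, h2]

theorem coeff_perturbation_eq_zero {a b : ℤ} {k : Freq}
    (hk : k ∉ ({mode a b 1, -mode a b 1, mode a b 2, -mode a b 2} : Finset Freq)) :
    coeff (perturbation a b) k = 0 := by
  simp only [Finset.mem_insert, Finset.mem_singleton, not_or] at hk
  rw [perturbation, coeff_add, coeff_realMode_eq_zero hk.1 hk.2.1,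
    coeff_realMode_eq_zero hk.2.2.1 hk.2.2.2, add_zero]

theorem norm_coeff_perturbation_le (a b : ℤ) (k : Freq) : ‖coeff (perturbation a b) k‖ ≤ 4 := by
  have h : ∀ l, ‖coeff (realMode 1 l) k‖ ≤ 2 := by
    intro l
    rw [coeff_realMode, map_one, one_mul, one_mul]
    refine (norm_add_le _ _).trans ?_
    split_ifs <;> norm_num
  rw [perturbation, coeff_add]
  refine (norm_add_le _ _).trans ?_
  linarith [h (mode a b 1), h (mode a b 2)]

/-- Time continuity is not part of the notion of solution; for each coefficient it comes from the
integrated equation. -/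
theorem IsSolution.continuousOn_coeff {normX : L2 → ℝ≥0∞} {t₁ : ℝ} {θ₀ : L2} {θ : ℝ → L2}
    (ht₁ : 0 ≤ t₁) (h : IsSolution T normX t₁ θ₀ θ) (k : Freq) :
    ContinuousOn (fun t => coeff (θ t) k) (Icc 0 t₁) := by
  have h1 := intervalIntegral.continuousOn_primitive_interval' (h.integrable k) left_mem_uIcc
  rw [uIcc_of_le ht₁] at h1
  exact (continuousOn_const.sub h1).congr fun t ht => h.equation t ht k

/-- Exponential growth of solutions which stay close to the steady state. -/
theorem IsSolution.growth {normX : L2 → ℝ≥0∞} {t₁ : ℝ} {θ : ℝ → L2} {q δ C Λ μ ε : ℝ} {a b : ℤ}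
    (hb : b ≠ 0) (hq : 1 ≤ q) (hC : 0 ≤ C) (hδ : 0 ≤ δ) (hε : 0 ≤ ε) (hμ : 0 ≤ μ) (ht₁ : 0 ≤ t₁)
    (hT : ∀ j, T axis j = 0) (hT' : ∀ j, T (-axis) j = 0)
    (hTC : ∀ k j, T k j ^ 2 ≤ C * (1 + normSq k) ^ q)
    (hm₀ : T (mode a b 0) 2 = 0) (hm : ∀ p, 0 ≤ T (mode a b p) 2)
    (hmΛ : ∀ p, T (mode a b p) 2 ≤ Λ)
    (hμ₁ : μ ≤ T (mode a b 1) 2) (hμ₂ : μ ≤ T (mode a b 2) 2)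
    (h : IsSolution T normX t₁ (steady + (ε : ℂ) • perturbation a b) θ)
    (hclose : ∀ t ∈ Icc 0 t₁, SobolevBound q δ (θ t - steady)) :
    ε * Real.exp (μ * t₁) - 2 * (3 * (C + 1) * δ ^ 2) * t₁ * Real.exp (4 * Λ * t₁) ≤ δ := by
  -- The coupling is real, so real parts satisfy the same chain. The steady state has no
  -- coefficients on it.
  set x : ℕ → ℝ → ℝ := fun p t => (coeff (θ t - steady : L2) (mode a b p)).re with hx
  have hxθ : ∀ p t, x p t = (coeff (θ t) (mode a b p)).re := by
    intro p t
    simp only [hx, coeff_sub, coeff_steady_of_ne (mode_ne_axis hb p) (mode_ne_neg_axis hb p),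
      sub_zero]
  have hxle : ∀ p, ∀ t ∈ Icc 0 t₁, |x p t| ≤ δ := fun p t ht =>
    (Complex.abs_re_le_norm _).trans ((hclose t ht).norm_coeff_le (by linarith) hδ _)
  have hcont : ∀ p, ContinuousOn (x p) (Icc 0 t₁) := by
    intro p
    refine ContinuousOn.congr ?_ fun t _ => hxθ p t
    exact Complex.continuous_re.comp_continuousOn (h.continuousOn_coeff ht₁ _)
  refine le_trans (chain_growth (m := fun p => T (mode a b p) 2)
    (b := fun p => if p = 1 ∨ p = 2 then ε else 0) (x := x) hm₀ hm hmΛ hμ hμ₁ hμ₂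
    (by positivity) hε ht₁ hcont hδ (fun p t ht => (abs_le.1 (hxle p t ht)).1)
    (fun p => by split_ifs <;> simp [hε]) (by simp) (by simp) ?_)
    ((le_abs_self _).trans (hxle 1 t₁ (right_mem_Icc.2 ht₁)))
  intro p t ht
  have hsub : ∀ s ∈ Icc 0 t, s ∈ Icc 0 t₁ := fun s hs => ⟨hs.1, hs.2.trans ht.2⟩
  have hint : IntervalIntegrable (fun σ => coeff (advection T (θ σ)) (mode a b (p + 1)))
      volume 0 t := by
    refine (h.integrable _).mono_set ?_
    rw [uIcc_of_le ht.1, uIcc_of_le ht₁]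
    exact Icc_subset_Icc_right ht.2
  have heq : x (p + 1) t = (if p + 1 = 1 ∨ p + 1 = 2 then ε else 0) +
      ∫ σ in (0 : ℝ)..t, -(coeff (advection T (θ σ)) (mode a b (p + 1))).re := by
    have h1 : (∫ σ in (0 : ℝ)..t, (coeff (advection T (θ σ)) (mode a b (p + 1))).re) =
        (∫ σ in (0 : ℝ)..t, coeff (advection T (θ σ)) (mode a b (p + 1))).re :=
      Complex.reCLM.intervalIntegral_comp_comm hint
    rw [hxθ, h.equation t ht, coeff_add,
      coeff_steady_of_ne (mode_ne_axis hb _) (mode_ne_neg_axis hb _), zero_add, coeff_smul,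
      coeff_perturbation_mode a hb, intervalIntegral.integral_neg, h1, Complex.sub_re,
      Complex.re_ofReal_mul, sub_eq_add_neg]
    congr 1
    split_ifs <;> simp
  rw [heq]
  refine add_le_add le_rfl (intervalIntegral.integral_mono_on ht.1 ?_ ?_ ?_)
  · refine ContinuousOn.intervalIntegrable_of_Icc ht.1 ?_
    have h1 := (hcont p).mono hsub
    have h2 := (hcont (p + 2)).mono hsub
    fun_prop
  · exact ⟨(Complex.reCLM.integrable_comp hint.1).neg, (Complex.reCLM.integrable_comp hint.2).neg⟩
  · intro s hs
    -- The quadratic remainder becomes the constant forcing `η` of the chain.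
    have h1 := norm_coeff_advection_steady_add_le hq hC hT hT' hTC (hclose s (hsub s hs))
      (mode a b (p + 1))
    rw [add_sub_cancel, mode_succ_sub_axis, mode_succ_add_axis] at h1
    have h2 := (abs_le.1 ((Complex.abs_re_le_norm _).trans h1)).2
    rw [Complex.add_re, Complex.add_re, Complex.re_ofReal_mul, Complex.re_ofReal_mul] at h2
    simp only [hx]
    linarith

/-! ### Gevrey norms of the initial data -/

/-- The square of the Gevrey norm. -/
def gevreySum (r s τ : ℝ) (f : L2) : ℝ≥0∞ :=
  ∑' k : {k : Freq // k ≠ 0}, ENNReal.ofReal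
    (kNorm k ^ (2 * r) * Real.exp (2 * τ * kNorm k ^ (1 / s)) * ‖coeff f k‖ ^ 2)

theorem gevreyNorm_eq (r s τ : ℝ) (f : L2) :
    gevreyNorm r s τ f = gevreySum r s τ f ^ (1 / 2 : ℝ) := rfl

theorem gevreyWeight_nonneg (r s τ : ℝ) (k : Freq) :
    0 ≤ kNorm k ^ (2 * r) * Real.exp (2 * τ * kNorm k ^ (1 / s)) := by
  have := kNorm_nonneg k
  positivity

theorem gevreySum_smul (r s τ c : ℝ) (f : L2) :
    gevreySum r s τ ((c : ℂ) • f) = ENNReal.ofReal (c ^ 2) * gevreySum r s τ f := by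
  rw [gevreySum, gevreySum, ← ENNReal.tsum_mul_left]
  congr 1
  ext k
  rw [← ENNReal.ofReal_mul (sq_nonneg c), coeff_smul, norm_mul, mul_pow, Complex.norm_real,
    Real.norm_eq_abs, sq_abs]
  congr 1
  ring

theorem gevreyNorm_smul (r s τ c : ℝ) (f : L2) :
    gevreyNorm r s τ ((c : ℂ) • f) = ENNReal.ofReal |c| * gevreyNorm r s τ f := by
  rw [gevreyNorm_eq, gevreySum_smul, ENNReal.mul_rpow_of_nonneg _ _ (by norm_num),
    ENNReal.ofReal_rpow_of_nonneg (sq_nonneg c) (by norm_num), ← Real.sqrt_eq_rpow,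
    Real.sqrt_sq_eq_abs, gevreyNorm_eq]

theorem gevreySum_add_of_disjoint {r s τ : ℝ} {f g : L2}
    (h : ∀ k, coeff f k = 0 ∨ coeff g k = 0) :
    gevreySum r s τ (f + g) = gevreySum r s τ f + gevreySum r s τ g := by
  rw [gevreySum, gevreySum, gevreySum, ← ENNReal.tsum_add]
  congr 1
  ext k
  rw [coeff_add]
  rcases h k with h | h <;> simp [h]

theorem gevreySum_le_of_support {r s τ X : ℝ} {f : L2} (S : Finset Freq)
    (hS : ∀ k ∉ S, coeff f k = 0)
    (hX : ∀ k ∈ S, kNorm k ^ (2 * r) * Real.exp (2 * τ * kNorm k ^ (1 / s)) *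
      ‖coeff f k‖ ^ 2 ≤ X) :
    gevreySum r s τ f ≤ S.card * ENNReal.ofReal X := by
  rw [gevreySum, tsum_eq_sum (s := S.subtype (· ≠ 0)) fun k hk => by
    rw [hS k (by simpa [k.2] using hk)]; simp]
  calc _ ≤ ∑ _k ∈ S.subtype (· ≠ 0), ENNReal.ofReal X :=
        Finset.sum_le_sum fun k hk => ENNReal.ofReal_le_ofReal (hX k (by simpa [k.2] using hk))
    _ = (S.subtype (· ≠ 0)).card * ENNReal.ofReal X := by rw [Finset.sum_const, nsmul_eq_mul]
    _ ≤ S.card * ENNReal.ofReal X := by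
        gcongr
        rw [Finset.card_subtype]
        exact Finset.card_filter_le _ _

theorem gevreySum_steady_ne_top (r s τ : ℝ) : gevreySum r s τ steady ≠ ∞ := by
  set F : Freq → ℝ := fun k => kNorm k ^ (2 * r) * Real.exp (2 * τ * kNorm k ^ (1 / s)) *
      ‖coeff steady k‖ ^ 2
  have hF : ∀ k, 0 ≤ F k := fun k => mul_nonneg (gevreyWeight_nonneg r s τ k) (sq_nonneg _)
  refine ne_top_of_le_ne_top (ENNReal.mul_ne_top (ENNReal.natCast_ne_top _) ENNReal.ofReal_ne_top)
    (gevreySum_le_of_support (X := F axis + F (-axis)) {axis, -axis} (fun k hk => ?_) ?_)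
  · simp only [Finset.mem_insert, Finset.mem_singleton, not_or] at hk
    exact coeff_steady_of_ne hk.1 hk.2
  · intro k hk
    simp only [Finset.mem_insert, Finset.mem_singleton] at hk
    rcases hk with rfl | rfl
    · exact le_add_of_nonneg_right (hF _)
    · exact le_add_of_nonneg_left (hF _)

theorem sobolevNorm_steady_lt_top (q : ℝ) : sobolevNorm q steady < ∞ := by
  rw [sobolevNorm]
  refine ENNReal.rpow_lt_top_of_nonneg (by norm_num) ?_
  rw [tsum_eq_sum (s := {axis, -axis}) fun k hk => by
    simp only [Finset.mem_insert, Finset.mem_singleton, not_or] at hk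
    rw [coeff_steady_of_ne hk.1 hk.2]; simp]
  exact (ENNReal.sum_lt_top.2 fun _ _ => ENNReal.ofReal_lt_top).ne

/-- Needed so that uniqueness forces the solution from `steady` to be constant in time. -/
theorem isSolution_steady {T : Freq → Fin 3 → ℝ} (hT : ∀ j, T axis j = 0)
    (hT' : ∀ j, T (-axis) j = 0) (q t₁ : ℝ) :
    IsSolution T (sobolevNorm q) t₁ steady (fun _ => steady) where
  realMeanFree _ _ := realMeanFree_steady
  measurable := aestronglyMeasurable_const
  bounded := (essSup_le_of_ae_le _ (Filter.EventuallyLE.refl _ _)).trans_lt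
    (sobolevNorm_steady_lt_top q)
  integrable k := by simp [coeff_advection_steady hT hT']
  equation t _ k := by simp [coeff_advection_steady hT hT']

theorem kNorm_mode_le {n : ℕ} (hn : 1 ≤ n) {p : ℕ} (hp2 : p ≤ 2) :
    kNorm (mode (n ^ 2) n p) ≤ 3 * (n : ℝ) ^ 2 := by
  have hp' : (p : ℝ) ≤ 2 := by exact_mod_cast hp2
  have hp2' : (p : ℝ) ^ 2 ≤ 4 := by nlinarith [(Nat.cast_nonneg p : (0 : ℝ) ≤ p)]
  have h1 : (1 : ℝ) ≤ (n : ℝ) ^ 2 := one_le_pow₀ (by exact_mod_cast hn)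
  refine Real.sqrt_le_iff.2 ⟨by positivity, ?_⟩
  rw [normSq_eq]
  simp only [mode_zero_apply, mode_one_apply, mode_two_apply]
  push_cast
  nlinarith

theorem gevreyNorm_perturbation_le {r s τ : ℝ} (hr : 0 ≤ r) (hs : 0 < s) (hτ : 0 ≤ τ) {n : ℕ}
    (hn : 1 ≤ n) : gevreyNorm r s τ (perturbation (n ^ 2) n) ≤
      ENNReal.ofReal (8 * ((3 * (n : ℝ) ^ 2) ^ r * Real.exp (τ * (3 * (n : ℝ) ^ 2) ^ (1 / s)))) := by
  set Y : ℝ := (3 * (n : ℝ) ^ 2) ^ r * Real.exp (τ * (3 * (n : ℝ) ^ 2) ^ (1 / s)) with hY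
  have hY0 : 0 ≤ Y := by positivity
  have hYsq : (3 * (n : ℝ) ^ 2) ^ (2 * r) * Real.exp (2 * τ * (3 * (n : ℝ) ^ 2) ^ (1 / s)) =
      Y ^ 2 := by
    rw [hY, mul_pow, ← Real.exp_nat_mul, mul_comm 2 r, Real.rpow_mul (by positivity),
      Real.rpow_two, mul_assoc 2 τ, Nat.cast_ofNat]
  have hbound : ∀ k : Freq, kNorm k ≤ 3 * (n : ℝ) ^ 2 →
      kNorm k ^ (2 * r) * Real.exp (2 * τ * kNorm k ^ (1 / s)) *
        ‖coeff (perturbation (n ^ 2) n) k‖ ^ 2 ≤ Y ^ 2 * 16 := by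
    intro k hk
    have h0 := kNorm_nonneg k
    have hs' : 0 ≤ 1 / s := by positivity
    rw [← hYsq]
    have h4 : ‖coeff (perturbation (n ^ 2) n) k‖ ^ 2 ≤ 16 := by
      have := norm_coeff_perturbation_le (n ^ 2) n k
      nlinarith [norm_nonneg (coeff (perturbation (n ^ 2) n) k)]
    gcongr
  have hcard : ({mode (n ^ 2) n 1, -mode (n ^ 2) n 1, mode (n ^ 2) n 2, -mode (n ^ 2) n 2} :
      Finset Freq).card ≤ 4 := Finset.card_le_four
  have hsum : gevreySum r s τ (perturbation (n ^ 2) n) ≤ ENNReal.ofReal ((8 * Y) ^ 2) := by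
    refine (gevreySum_le_of_support (X := Y ^ 2 * 16) _
      (fun k hk => coeff_perturbation_eq_zero hk) ?_).trans ?_
    · intro k hk
      refine hbound k ?_
      simp only [Finset.mem_insert, Finset.mem_singleton] at hk
      rcases hk with rfl | rfl | rfl | rfl
      · exact kNorm_mode_le hn (by norm_num)
      · rw [kNorm_neg]; exact kNorm_mode_le hn (by norm_num)
      · exact kNorm_mode_le hn (by norm_num)
      · rw [kNorm_neg]; exact kNorm_mode_le hn (by norm_num)
    -- Four frequencies with squared coefficients at most $16$ give $64=8^2$.
    · calc _ ≤ ((4 : ℕ) : ℝ≥0∞) * ENNReal.ofReal (Y ^ 2 * 16) := by gcongr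
        _ = ENNReal.ofReal ((8 * Y) ^ 2) := by
          rw [← ENNReal.ofReal_natCast, ← ENNReal.ofReal_mul (by norm_num)]
          congr 1
          push_cast
          ring
  rw [gevreyNorm_eq]
  refine (ENNReal.rpow_le_rpow hsum (by norm_num)).trans (le_of_eq ?_)
  rw [ENNReal.ofReal_rpow_of_nonneg (sq_nonneg _) (by norm_num), ← Real.sqrt_eq_rpow,
    Real.sqrt_sq (by positivity)]

open Filter Topology

/-- Disjoint spectra make the squared norm additive, hence explicit in `ε`. Together with continuity
of the time and Lipschitz functions this allows both to be evaluated at the steady state in the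
limit. -/
theorem tendsto_gevreyNorm_steady_add {r s τ : ℝ} {f : L2} (hf : gevreySum r s τ f ≠ ∞)
    (h : ∀ k, coeff steady k = 0 ∨ coeff f k = 0) :
    Tendsto (fun ε : ℝ => (gevreyNorm r s τ (steady + (ε : ℂ) • f)).toNNReal) (𝓝[>] 0)
      (𝓝 (gevreyNorm r s τ steady).toNNReal) := by
  have hfin : gevreyNorm r s τ steady ≠ ∞ :=
    (ENNReal.rpow_lt_top_of_nonneg (by norm_num) (gevreySum_steady_ne_top r s τ)).ne
  refine (ENNReal.tendsto_toNNReal hfin).comp ?_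
  have h1 : ∀ ε : ℝ, gevreyNorm r s τ (steady + (ε : ℂ) • f) =
      (gevreySum r s τ steady + ENNReal.ofReal (ε ^ 2) * gevreySum r s τ f) ^ (1 / 2 : ℝ) := by
    intro ε
    rw [gevreyNorm_eq, gevreySum_add_of_disjoint, gevreySum_smul]
    intro k
    rw [coeff_smul]
    rcases h k with h | h <;> simp [h]
  simp only [h1, gevreyNorm_eq]
  refine (ENNReal.continuous_rpow_const.tendsto _).comp ?_
  have h2 : Tendsto (fun ε : ℝ => ENNReal.ofReal (ε ^ 2)) (𝓝[>] 0) (𝓝 0) := by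
    have : Continuous fun ε : ℝ => ENNReal.ofReal (ε ^ 2) :=
      ENNReal.continuous_ofReal.comp (continuous_pow 2)
    have h3 := this.tendsto 0
    simp only [ne_eq, OfNat.ofNat_ne_zero, not_false_eq_true, zero_pow, ENNReal.ofReal_zero] at h3
    exact h3.mono_left nhdsWithin_le_nhds
  have h4 := (ENNReal.Tendsto.mul_const h2 (Or.inr hf)).const_add (gevreySum r s τ steady)
  rwa [zero_mul, add_zero] at h4

/-! ### Contradiction with well-posedness -/

/-- Well-posedness limits the growth rate of the linearisation at the steady state by the Gevrey
norm of the initial perturbation. -/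
theorem exp_le_of_wellPosed {T : Freq → Fin 3 → ℝ} {q r s τ C Λ μ : ℝ} {a b : ℤ}
    (hb : b ≠ 0) (hq : 1 ≤ q) (hC : 0 ≤ C) (hμ : 0 ≤ μ)
    (hT : ∀ j, T axis j = 0) (hT' : ∀ j, T (-axis) j = 0)
    (hTC : ∀ k j, T k j ^ 2 ≤ C * (1 + normSq k) ^ q)
    (hm₀ : T (mode a b 0) 2 = 0) (hm : ∀ p, 0 ≤ T (mode a b p) 2)
    (hmΛ : ∀ p, T (mode a b p) 2 ≤ Λ)
    (hμ₁ : μ ≤ T (mode a b 1) 2) (hμ₂ : μ ≤ T (mode a b 2) 2)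
    {G : ℝ} (hG : 0 ≤ G) (hGn : gevreyNorm r s τ (perturbation a b) ≤ ENNReal.ofReal G)
    {time lip : ℝ≥0 × ℝ≥0 → ℝ} (htime : Continuous time) (hlip : Continuous lip)
    (htime₀ : ∀ p, 0 < time p) (hlip₀ : ∀ p, 0 < lip p)
    (hwp : ∀ φ₁ φ₂ : L2, RealMeanFree φ₁ → gevreyNorm r s τ φ₁ < ∞ → RealMeanFree φ₂ →
      gevreyNorm r s τ φ₂ < ∞ →
      ∃ θ₁ θ₂ : ℝ → L2,
        IsSolution T (sobolevNorm q) (time ((gevreyNorm r s τ φ₁).toNNReal,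
          (gevreyNorm r s τ φ₂).toNNReal)) φ₂ θ₂ ∧
        (∀ θ, IsSolution T (sobolevNorm q) (time ((gevreyNorm r s τ φ₁).toNNReal,
          (gevreyNorm r s τ φ₂).toNNReal)) φ₁ θ →
          EqOn θ θ₁ (Icc 0 (time ((gevreyNorm r s τ φ₁).toNNReal,
            (gevreyNorm r s τ φ₂).toNNReal)))) ∧
        ∀ t ∈ Icc 0 (time ((gevreyNorm r s τ φ₁).toNNReal, (gevreyNorm r s τ φ₂).toNNReal)),
          sobolevNorm q (θ₁ t - θ₂ t) ≤ ENNReal.ofReal (lip ((gevreyNorm r s τ φ₁).toNNReal,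
            (gevreyNorm r s τ φ₂).toNNReal)) * gevreyNorm r s τ (φ₁ - φ₂)) :
    Real.exp (μ * time ((gevreyNorm r s τ steady).toNNReal, (gevreyNorm r s τ steady).toNNReal)) ≤
      lip ((gevreyNorm r s τ steady).toNNReal, (gevreyNorm r s τ steady).toNNReal) * G := by
  set p₀ := (gevreyNorm r s τ steady).toNNReal with hp₀
  set p : ℝ → ℝ≥0 := fun ε =>
    (gevreyNorm r s τ (steady + (ε : ℂ) • perturbation a b)).toNNReal with hp
  have hpert : gevreyNorm r s τ (perturbation a b) < ∞ := hGn.trans_lt ENNReal.ofReal_lt_top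
  have hpertSum : gevreySum r s τ (perturbation a b) ≠ ∞ := by
    intro h
    rw [gevreyNorm_eq, h] at hpert
    simp at hpert
  have hsteady : gevreyNorm r s τ steady < ∞ :=
    ENNReal.rpow_lt_top_of_nonneg (by norm_num) (gevreySum_steady_ne_top r s τ)
  have hdisj : ∀ k, coeff steady k = 0 ∨ coeff (perturbation a b) k = 0 := by
    intro k
    by_cases h1 : k = axis
    · right
      apply coeff_perturbation_eq_zero
      simp only [Finset.mem_insert, Finset.mem_singleton, not_or, h1]
      refine ⟨(mode_ne_axis hb _).symm, ?_, (mode_ne_axis hb _).symm, ?_⟩ <;>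
      · intro h
        exact mode_ne_neg_axis hb _ (neg_eq_iff_eq_neg.1 h.symm)
    by_cases h2 : k = -axis
    · right
      apply coeff_perturbation_eq_zero
      simp only [Finset.mem_insert, Finset.mem_singleton, not_or, h2]
      refine ⟨(mode_ne_neg_axis hb _).symm, ?_, (mode_ne_neg_axis hb _).symm, ?_⟩ <;>
      · intro h
        exact mode_ne_axis hb _ (neg_injective h).symm
    exact Or.inl (coeff_steady_of_ne h1 h2)
  -- The growth estimate with $\delta=K\varepsilon G$, divided by `ε`: the linear terms become
  -- independent of the explicit `ε`, and the quadratic error keeps one factor of it.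
  have hgrowth : ∀ ε : ℝ, 0 < ε → Real.exp (μ * time (p₀, p ε)) -
      ε * (6 * (C + 1) * (lip (p₀, p ε) * G) ^ 2 * time (p₀, p ε) *
        Real.exp (4 * Λ * time (p₀, p ε))) ≤ lip (p₀, p ε) * G := by
    intro ε hε
    have hfin : gevreyNorm r s τ (steady + (ε : ℂ) • perturbation a b) < ∞ := by
      refine ENNReal.rpow_lt_top_of_nonneg (by norm_num) ?_
      change gevreySum r s τ _ ≠ ∞
      rw [gevreySum_add_of_disjoint, gevreySum_smul]
      · exact ENNReal.add_ne_top.2 ⟨gevreySum_steady_ne_top r s τ,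
          ENNReal.mul_ne_top ENNReal.ofReal_ne_top hpertSum⟩
      · intro k
        rw [coeff_smul]
        rcases hdisj k with h | h <;> simp [h]
    obtain ⟨θ₁, θ₂, hθ₂, huniq, hbound⟩ := hwp steady (steady + (ε : ℂ) • perturbation a b)
      realMeanFree_steady hsteady
      (realMeanFree_steady.add ((realMeanFree_perturbation a hb).smul ε)) hfin
    have hθ₁ := huniq _ (isSolution_steady hT hT' q _)
    change IsSolution T (sobolevNorm q) (time (p₀, p ε)) _ θ₂ at hθ₂
    change EqOn _ _ (Icc 0 (time (p₀, p ε))) at hθ₁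
    change ∀ t ∈ Icc 0 (time (p₀, p ε)), _ ≤ ENNReal.ofReal (lip (p₀, p ε)) * _ at hbound
    have ht := htime₀ (p₀, p ε)
    have hl := hlip₀ (p₀, p ε)
    set t₁ := time (p₀, p ε)
    set K := lip (p₀, p ε)
    have hclose : ∀ t ∈ Icc 0 t₁, SobolevBound q (K * (ε * G)) (θ₂ t - steady) := by
      intro t ht'
      have h1 : sobolevNorm q (steady - θ₂ t) ≤ ENNReal.ofReal (K * (ε * G)) := by
        have h2 := hbound t ht'
        rw [← hθ₁ ht'] at h2
        refine h2.trans ?_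
        have h3 : steady - (steady + (ε : ℂ) • perturbation a b) =
            ((-ε : ℝ) : ℂ) • perturbation a b := by
          push_cast
          rw [sub_add_cancel_left, neg_smul]
        rw [h3, gevreyNorm_smul, abs_neg, abs_of_pos hε, ENNReal.ofReal_mul hl.le,
          ENNReal.ofReal_mul hε.le]
        gcongr
      have h4 := sobolevBound_of_sobolevNorm_le (by positivity) h1
      have h5 : ∀ k, ‖coeff (steady - θ₂ t : L2) k‖ = ‖coeff (θ₂ t - steady : L2) k‖ := by
        intro k
        rw [coeff_sub, coeff_sub, norm_sub_rev]
      simpa only [SobolevBound, h5] using h4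
    have h6 := hθ₂.growth hb hq hC (by positivity) hε.le hμ ht.le hT hT' hTC hm₀ hm hmΛ hμ₁ hμ₂
      hclose
    refine le_of_mul_le_mul_left ?_ hε
    linarith
  have hppair : Tendsto (fun ε => (p₀, p ε)) (𝓝[>] (0 : ℝ)) (𝓝 (p₀, p₀)) :=
    tendsto_const_nhds.prodMk_nhds (tendsto_gevreyNorm_steady_add hpertSum hdisj)
  have htt := (htime.tendsto (p₀, p₀)).comp hppair
  have hlt := (hlip.tendsto (p₀, p₀)).comp hppair
  have hε0 : Tendsto (fun ε : ℝ => ε) (𝓝[>] 0) (𝓝 0) := tendsto_id.mono_left nhdsWithin_le_nhds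
  have hlhs := (((Real.continuous_exp.tendsto _).comp (htt.const_mul μ))).sub
    (hε0.mul ((((((hlt.mul_const G).pow 2).const_mul (6 * (C + 1))).mul htt)).mul
      ((Real.continuous_exp.tendsto _).comp (htt.const_mul (4 * Λ)))))
  rw [zero_mul, sub_zero] at hlhs
  -- The chain is fixed as `ε → 0`, so the possibly huge factor $e^{4\Lambda t}$ disappears with the
  -- error.
  refine le_of_tendsto_of_tendsto hlhs (hlt.mul_const G) ?_
  filter_upwards [self_mem_nhdsWithin] with ε hε
  exact hgrowth ε hε

theorem isLittleO_rpow_rpow_of_lt {a b : ℝ} (h : b < a) :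
    (fun x : ℝ => x ^ b) =o[atTop] fun x : ℝ => x ^ a := by
  refine (Asymptotics.isLittleO_iff_tendsto' ?_).2 ?_
  · filter_upwards [eventually_gt_atTop 0] with x hx h0
    exact absurd h0 (Real.rpow_pos_of_pos hx a).ne'
  · refine (tendsto_rpow_neg_atTop (sub_pos.2 h)).congr' ?_
    filter_upwards [eventually_gt_atTop 0] with x hx
    rw [neg_sub, Real.rpow_sub hx]

/-- An exponential of `N ^ a` dominates `N ^ r * exp (N ^ b)` for `b < a`. -/
theorem eventually_lt_exp_rpow {a b c d r τ K : ℝ} (ha : 0 < a) (hba : b < a) (hc : 0 < c)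
    (hd : 0 < d) (hK : 0 < K) :
    ∀ᶠ N : ℝ in atTop, K * ((d * N) ^ r * Real.exp (τ * (d * N) ^ b)) < Real.exp (c * N ^ a) := by
  -- The logarithm of the left-hand side: constants, $\log N$ and $N^b$ are all negligible against
  -- $N^a$.
  have h1 : (fun N : ℝ => Real.log K + r * (Real.log d + Real.log N) + τ * (d ^ b * N ^ b))
      =o[atTop] fun N : ℝ => N ^ a := by
    have hconst : ∀ x : ℝ, (fun _ : ℝ => x) =o[atTop] fun N : ℝ => N ^ a := fun x =>
      Asymptotics.isLittleO_const_left.2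
        (Or.inr (tendsto_norm_atTop_atTop.comp (tendsto_rpow_atTop ha)))
    have hpow : (fun N : ℝ => N ^ b) =o[atTop] fun N : ℝ => N ^ a :=
      isLittleO_rpow_rpow_of_lt hba
    exact ((hconst _).add (((hconst _).add (isLittleO_log_rpow_atTop ha)).const_mul_left r)).add
      ((hpow.const_mul_left _).const_mul_left _)
  filter_upwards [h1.bound (half_pos hc), eventually_gt_atTop 0] with N hN hN0
  have hNa : 0 < N ^ a := Real.rpow_pos_of_pos hN0 a
  have h2 : K * ((d * N) ^ r * Real.exp (τ * (d * N) ^ b)) =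
      Real.exp (Real.log K + r * (Real.log d + Real.log N) + τ * (d ^ b * N ^ b)) := by
    rw [Real.exp_add, Real.exp_add, Real.exp_log hK, ← Real.log_mul hd.ne' hN0.ne', mul_comm r,
      ← Real.rpow_def_of_pos (by positivity), Real.mul_rpow hd.le hN0.le,
      Real.mul_rpow hd.le hN0.le]
    ring
  rw [h2, Real.exp_lt_exp]
  rw [Real.norm_of_nonneg hNa.le] at hN
  have h3 := (le_abs_self _).trans hN
  have h4 : 0 < c * N ^ a := by positivity
  linarith

theorem lipschitzIllPosed_generalizedMGSymbol {Ω β η r α q s τ : ℝ} (hΩ : 0 < Ω) (hβ : 0 < β)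
    (hη : 0 < η) (hr : 0 ≤ r) (hα : 0 ≤ α) (hα1 : α ≤ 1) (hq : α + 1 ≤ q)
    (hs : 1 / (α + 1) < s) (hτ : 0 ≤ τ) :
    LipschitzIllPosed (generalizedMGSymbol Ω β η α) (sobolevNorm q) (gevreyNorm r s τ) := by
  rintro ⟨time, lip, htime, hlip, htime₀, hlip₀, hwp⟩
  have hs0 : 0 < s := lt_trans (by positivity) hs
  have hs1 : 1 / s < α + 1 := by rwa [one_div_lt hs0 (by positivity)]
  set P := ((gevreyNorm r s τ steady).toNNReal, (gevreyNorm r s τ steady).toNNReal)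
  have hT : ∀ j, generalizedMGSymbol Ω β η α axis j = 0 := fun j => by
    rw [generalizedMGSymbol, mgSymbol_axis, smul_zero, Pi.zero_apply]
  have hT' : ∀ j, generalizedMGSymbol Ω β η α (-axis) j = 0 := fun j => by
    rw [generalizedMGSymbol, mgSymbol_neg_axis, smul_zero, Pi.zero_apply]
  set c := (β ^ 2 / η) / (96 * Ω ^ 2 + (β ^ 2 / η) ^ 2)
  have hc : 0 < c := by positivity
  -- `P` depends only on the steady state, so the time and the Lipschitz constant are the same for
  -- all `n`.
  have key : ∀ n : ℕ, 1 ≤ n → Real.exp (c * ((n : ℝ) ^ 2) ^ (α + 1) * time P) ≤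
      lip P * (8 * ((3 * (n : ℝ) ^ 2) ^ r * Real.exp (τ * (3 * (n : ℝ) ^ 2) ^ (1 / s)))) := by
    intro n hn
    refine exp_le_of_wellPosed (a := n ^ 2) (b := n) (C := (1 / Ω) ^ 2)
      (Λ := (β ^ 2 / η) * ((n : ℤ) : ℝ) ^ 2 * ((((n : ℤ) ^ 2 : ℤ) : ℝ) ^ 2 + ((n : ℤ) : ℝ) ^ 2) /
        (4 * Ω ^ 2)) (by omega) (by linarith)
      (by positivity) (by positivity) hT hT'
      (sq_generalizedMGSymbol_le hΩ hβ hη hα hq)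
      (by rw [generalizedMGSymbol_of_eq_zero (by simp), Pi.zero_apply])
      (fun p => generalizedMGSymbol_two_nonneg hη _)
      (fun p => generalizedMGSymbol_two_le hΩ hη hα1 _)
      (le_generalizedMGSymbol_mode hΩ hβ hη hα hn (by norm_num) (by norm_num))
      (le_generalizedMGSymbol_mode hΩ hβ hη hα hn (by norm_num) (by norm_num))
      (by positivity) (gevreyNorm_perturbation_le hr hs0 hτ hn) htime hlip htime₀ hlip₀ ?_
    intro φ₁ φ₂ h1 h2 h3 h4
    obtain ⟨θ₁, θ₂, -, h5, h6, -, h7⟩ := hwp φ₁ φ₂ h1 h2 h3 h4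
    exact ⟨θ₁, θ₂, h5, h6, h7⟩
  have hlim : Tendsto (fun n : ℕ => (n : ℝ) ^ 2) atTop atTop :=
    (tendsto_pow_atTop two_ne_zero).comp tendsto_natCast_atTop_atTop
  have hev := hlim.eventually (eventually_lt_exp_rpow (a := α + 1) (b := 1 / s) (r := r) (τ := τ)
    (c := c * time P) (d := 3) (K := lip P * 8) (by positivity) hs1
    (mul_pos hc (htime₀ P)) (by norm_num) (mul_pos (hlip₀ P) (by norm_num)))
  obtain ⟨n, hn, hn1⟩ := (hev.and (eventually_ge_atTop 1)).exists
  refine absurd (key n hn1) (not_le.2 ?_)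
  rw [mul_right_comm, ← mul_assoc]
  exact hn

theorem generalizedMGSymbol_zero (Ω β η : ℝ) :
    generalizedMGSymbol Ω β η 0 = mgSymbol Ω β η := by
  ext k j
  simp [generalizedMGSymbol]

end ActiveScalar

end

theorem mainTheorem4 (Ω β η : ℝ) (hΩ : 0 < Ω) (hβ : 0 < β) (hη : 0 < η)
    (r : ℝ) (hr : 3 < r) :
    (∀ α q s τ : ℝ, 0 ≤ α → α ≤ 1 → α + 7 / 4 < q → 1 / (α + 1) < s → 0 < τ →
      ActiveScalar.LipschitzIllPosed (ActiveScalar.generalizedMGSymbol Ω β η α)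
        (ActiveScalar.sobolevNorm q) (ActiveScalar.gevreyNorm r s τ)) ∧
    (∀ q s τ : ℝ, 7 / 4 < q → 1 < s → 0 < τ →
      ActiveScalar.LipschitzIllPosed (ActiveScalar.mgSymbol Ω β η)
        (ActiveScalar.sobolevNorm q) (ActiveScalar.gevreyNorm r s τ)) := by
  have hr' : 0 ≤ r := by linarith
  refine ⟨fun α q s τ hα hα1 hq hs hτ =>
    ActiveScalar.lipschitzIllPosed_generalizedMGSymbol hΩ hβ hη hr' hα hα1 (by linarith) hs hτ.le,
    fun q s τ hq hs hτ => ?_⟩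
  rw [← ActiveScalar.generalizedMGSymbol_zero]
  exact ActiveScalar.lipschitzIllPosed_generalizedMGSymbol hΩ hβ hη hr' le_rfl zero_le_one
    (by linarith) (by simpa using hs) hτ.le
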